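/- Fix a relational vocabulary $\tau$. All $\tau$-structures $\mathfrak A$ are finite and have at least two elements. For $k\ge 0$, a function $f\colon A^k\to\mathbb N$ encodes the finite multiteam $M_f$ over $\mathfrak A$ with domain $\{x_1,\dots,x_k\}$ in which the assignment $\bar x\mapsto\bar a$ has multiplicity $f(\bar a)$; the triple $(\mathfrak A,\mathbb N,\{f\})$ is called a multiteam structure. $\mathrm{ESO}^{\mathsf{mts}}[+]$ is the set of sentences $$\psi(f)=(\exists g_1\preceq b_1)\cdots(\exists g_m\preceq b_m)\,\varphi(f,g_1,\dots,g_m),\qquad b_i=|f|\cdot|A|^{\ell_i},\ \ell_i\ge 0,$$ where $\varphi$ is built from literals $\alpha$ of $\tau$ (with equality) and equations $t=t'$ by $\land,\lor,\exists x,\forall x$ (quantifiers range over $A$; equations are not negated), and numeric terms are given by $$t::=0\mid h\bar x\mid t+t\mid \Sigma_{\bar x}\{t:\alpha\}\qquad(h\in\{f,g_1,\dots,g_m\}),$$ with $\alpha$ a literal or $\mathsf{true}$ and $\Sigma_{\bar x}\{t:\alpha\}$ denoting the sum of the values of $t$ over all values of $\bar x$ that satisfy $\alpha$. The sentence $\psi(f)$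 holds in $(\mathfrak A,\mathbb N,\{f\})$ iff there are $g_i\colon A^{r_i}\to\mathbb N$ of the appropriate arities with $\sum_{\bar a}g_i(\bar a)\le |A|^{\ell_i}\sum_{\bar a}f(\bar a)$ that satisfy $\varphi$ under the usual Tarski semantics. $\mathrm{FO}^{\mathsf M}[\subseteq,|]$ is the closure of the literals of $\tau$, the multiteam inclusion atoms $\bar x\subseteq\bar y$ and the exclusion atoms $\bar x\mid\bar y$ (with $\bar x,\bar y$ of equal length) under $\land,\lor,\exists,\forall$, with the following semantics over a multiteam $M$. A literal holds if it holds for every assignment in $M$. The atom $\bar x\subseteq\bar y$ holds if the multiset $\{\!\{s(\bar x):s\in M\}\!\}$ is a submultiset of $\{\!\{s(\bar y):s\in M\}\!\}$. The atom $\bar x\mid\bar y$ holds if $s(\bar x)\ne s'(\bar y)$ for all $s,s'\in M$. Conjunction is as usual. $\phi\lor\psi$ holds if $M=M_1\uplus M_2$ (additive union) where $M_1$ satisfies $\phi$ and $M_2$ satisfies $\psi$. $\forall x\,\phi$ holds if $\{\!\{s[x\mapsto a]:s\in M,\ a\in A\}\!\}$ satisfies $\phi$. $\exists x\,\phi$ holds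 if some multiteam obtained from $M$ by extending each occurrence of each assignment by one chosen value for $x$ satisfies $\phi$. **Theorem.** Let $\psi(f)\in\mathrm{ESO}^{\mathsf{mts}}[+]$, with $f$ a $k$-ary function symbol, be such that $\psi(0)$ is a tautology, i.e. $(\mathfrak A,\mathbb N,\{0\})\models\psi$ for every $\mathfrak A$ as above. Then there is a formula $\phi\in\mathrm{FO}^{\mathsf M}[\subseteq,|]$ with free variables among $x_1,\dots,x_k$ such that for every multiteam structure $(\mathfrak A,\mathbb N,\{f\})$ for which $M_f$ is non-empty, $$\mathfrak A\models_{M_f}\phi\iff(\mathfrak A,\mathbb N,\{f\})\models\psi(f).$$ -/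

import Mathlib

universe u v w

namespace MultiteamLogic

/-! Variables are well scoped: a formula of scope `n` has its free variables among
`x₀, …, x₍ₙ₋₁₎`, and an assignment with this domain is a function `Fin n → A`.
A quantifier binds the new last variable. -/

/-- First-order literals of a relational vocabulary `L` (with equality). -/
inductive Literal (L : FirstOrder.Language.{u, v}) (n : ℕ) : Type v
  | eq (i j : Fin n) : Literal L n
  | ne (i j : Fin n) : Literal L n
  | rel {a : ℕ} (R : L.Relations a) (x : Fin a → Fin n) : Literal L n
  | nrel {a : ℕ} (R : L.Relations a) (x : Fin a → Fin n) : Literal L n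

/-- Tarski semantics of literals. -/
def Literal.Holds {L : FirstOrder.Language.{u, v}} {n : ℕ} {A : Type w} [L.Structure A] :
    Literal L n → (Fin n → A) → Prop
  | .eq i j, s => s i = s j
  | .ne i j, s => s i ≠ s j
  | .rel R x, s => FirstOrder.Language.Structure.RelMap R (s ∘ x)
  | .nrel R x, s => ¬ FirstOrder.Language.Structure.RelMap R (s ∘ x)

/-! ### Multiteams and the logic with multiteam semantics -/

/-- A (finite) multiteam with domain `x₀, …, x₍ₙ₋₁₎` and values in `A`. -/
abbrev Multiteam (A : Type w) (n : ℕ) : Type w := Multiset (Fin n → A)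

namespace Multiteam

/-- The universal extension `M[x ↦ A]`: the multiset of all `s[x ↦ a]` with `s ∈ M`, `a ∈ A`. -/
def univExt {A : Type w} [Fintype A] {n : ℕ} (M : Multiteam A n) : Multiteam A (n + 1) :=
  M.bind fun s => (Finset.univ : Finset A).val.map fun a => (Fin.snoc s a : Fin (n + 1) → A)

open Classical in
/-- The Skolem extension `M[x ↦ F]` for a choice function `F`. The coercion of the multiset `M`
to a type is the type of all occurrences `(s, i)` with `i < M.count s`, so that different
occurrences of the same assignment may receive different values. -/
noncomputable def skolemExt {A : Type w} {n : ℕ} (M : Multiteam A n) (F : M → A) :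
    Multiteam A (n + 1) :=
  (Finset.univ : Finset M).val.map fun p => (Fin.snoc p.1 (F p) : Fin (n + 1) → A)

/-- The multiteam `M_f` represented by `f : A^k → ℕ`: the assignment `a` has multiplicity `f a`. -/
def ofFun {A : Type w} [Fintype A] {k : ℕ} (f : (Fin k → A) → ℕ) :
    Multiteam A k :=
  ∑ a : Fin k → A, f a • {a}

theorem count_ofFun {A : Type w} [Fintype A] [DecidableEq A] {k : ℕ} (f : (Fin k → A) → ℕ)
    (a : Fin k → A) : (ofFun f).count a = f a := by
  simp [ofFun, Multiset.count_sum', Multiset.count_singleton]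

end Multiteam

/-- Formulae (in negation normal form) of first-order logic with multiteam inclusion atoms and
exclusion atoms. -/
inductive FOM (L : FirstOrder.Language.{u, v}) : ℕ → Type v
  | lit {n : ℕ} (α : Literal L n) : FOM L n
  | incl {n l : ℕ} (x y : Fin l → Fin n) : FOM L n
  | excl {n l : ℕ} (x y : Fin l → Fin n) : FOM L n
  | and {n : ℕ} (φ ψ : FOM L n) : FOM L n
  | or {n : ℕ} (φ ψ : FOM L n) : FOM L n
  | all {n : ℕ} (φ : FOM L (n + 1)) : FOM L n
  | ex {n : ℕ} (φ : FOM L (n + 1)) : FOM L n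

open Classical in
/-- Multiteam semantics. For multisets, `≤` is submultiset and `+` is additive union. -/
def FOM.Sat {L : FirstOrder.Language.{u, v}} {A : Type w} [L.Structure A] [Fintype A] :
    {n : ℕ} → FOM L n → Multiteam A n → Prop
  | _, .lit α, M => ∀ s ∈ M, α.Holds s
  | _, .incl x y, M => M.map (fun s => s ∘ x) ≤ M.map (fun s => s ∘ y)
  | _, .excl x y, M => ∀ s ∈ M, ∀ s' ∈ M, s ∘ x ≠ s' ∘ y
  | _, .and φ ψ, M => φ.Sat M ∧ ψ.Sat M
  | _, .or φ ψ, M => ∃ M₁ M₂ : Multiteam A _, M₁ + M₂ = M ∧ φ.Sat M₁ ∧ ψ.Sat M₂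
  | _, .all φ, M => φ.Sat M.univExt
  | _, .ex φ, M => ∃ F : M → A, φ.Sat (M.skolemExt F)

/-! ### Presburger first-order logic of multiteam structures -/

/-- Numeric terms over weight function symbols `W` with arities `ar`, without multiplication:
`0`, `g x`, `t + t'` and `Σ_y { t : α }`. The summation binds the `l` new last variables; its
guard is a literal, or `none` for the trivial guard `true`. -/
inductive NumTerm (L : FirstOrder.Language.{u, v}) (W : Type) (ar : W → ℕ) : ℕ → Type v
  | zero {n : ℕ} : NumTerm L W ar n
  | app {n : ℕ} (g : W) (x : Fin (ar g) → Fin n) : NumTerm L W ar n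
  | add {n : ℕ} (t t' : NumTerm L W ar n) : NumTerm L W ar n
  | sum {n : ℕ} (l : ℕ) (t : NumTerm L W ar (n + l)) (α : Option (Literal L (n + l))) :
      NumTerm L W ar n

open Classical in
/-- The value of a numeric term, for an interpretation `I` of the weight function symbols. -/
noncomputable def NumTerm.val {L : FirstOrder.Language.{u, v}} {W : Type} {ar : W → ℕ} {A : Type w}
    [L.Structure A] [Fintype A] (I : (g : W) → (Fin (ar g) → A) → ℕ) :
    {n : ℕ} → NumTerm L W ar n → (Fin n → A) → ℕ
  | _, .zero, _ => 0
  | _, .app g x, s => I g (s ∘ x)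
  | _, .add t t', s => t.val I s + t'.val I s
  | _, .sum l t α, s =>
      ∑ b : Fin l → A, if ∀ β ∈ α, β.Holds (Fin.append s b) then t.val I (Fin.append s b) else 0

/-- Formulae of the Presburger fragment; equations between numeric terms occur only positively, and
quantifiers range over the elements of the structure. -/
inductive FOmts (L : FirstOrder.Language.{u, v}) (W : Type) (ar : W → ℕ) : ℕ → Type v
  | lit {n : ℕ} (α : Literal L n) : FOmts L W ar n
  | teq {n : ℕ} (t t' : NumTerm L W ar n) : FOmts L W ar n
  | and {n : ℕ} (φ ψ : FOmts L W ar n) : FOmts L W ar n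
  | or {n : ℕ} (φ ψ : FOmts L W ar n) : FOmts L W ar n
  | ex {n : ℕ} (φ : FOmts L W ar (n + 1)) : FOmts L W ar n
  | all {n : ℕ} (φ : FOmts L W ar (n + 1)) : FOmts L W ar n

/-- Tarski semantics. -/
def FOmts.Holds {L : FirstOrder.Language.{u, v}} {W : Type} {ar : W → ℕ} {A : Type w}
    [L.Structure A] [Fintype A] (I : (g : W) → (Fin (ar g) → A) → ℕ) :
    {n : ℕ} → FOmts L W ar n → (Fin n → A) → Prop
  | _, .lit α, s => α.Holds s
  | _, .teq t t', s => t.val I s = t'.val I s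
  | _, .and φ ψ, s => φ.Holds I s ∧ ψ.Holds I s
  | _, .or φ ψ, s => φ.Holds I s ∨ ψ.Holds I s
  | _, .ex φ, s => ∃ a : A, φ.Holds I (Fin.snoc s a)
  | _, .all φ, s => ∀ a : A, φ.Holds I (Fin.snoc s a)

/-! ### Bounded existential second-order logic of multiteam structures -/

/-- The arities of the weight function symbols `f` (`none`) and `g₀, …, g₍ₘ₋₁₎` (`some i`). -/
def weightArity (k : ℕ) {m : ℕ} (r : Fin m → ℕ) : Option (Fin m) → ℕ
  | none => k
  | some i => r i

/-- The interpretation of `f` and `g₀, …, g₍ₘ₋₁₎` by given functions. -/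
def weightInterp {A : Type w} {k m : ℕ} {r : Fin m → ℕ} (f : (Fin k → A) → ℕ)
    (g : (i : Fin m) → (Fin (r i) → A) → ℕ) :
    (h : Option (Fin m)) → (Fin (weightArity k r h) → A) → ℕ
  | none => f
  | some i => g i

/-- Sentences `ψ(f) = (∃ g₀ ≼ |f|·|A|^ℓ₀) ⋯ (∃ g₍ₘ₋₁₎ ≼ |f|·|A|^ℓ₍ₘ₋₁₎) φ(f, g₀, …, g₍ₘ₋₁₎)` for a
`k`-ary weight function symbol `f`, where `gᵢ` has arity `arity i` and `ℓᵢ` is `expo i`. -/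
structure ESOmts (L : FirstOrder.Language.{u, v}) (k : ℕ) : Type v where
  m : ℕ
  arity : Fin m → ℕ
  expo : Fin m → ℕ
  body : FOmts L (Option (Fin m)) (weightArity k arity) 0

/-- `(A, ℕ, {f}) ⊨ ψ(f)`. -/
def ESOmts.Holds {L : FirstOrder.Language.{u, v}} {k : ℕ} (ψ : ESOmts L k) {A : Type w} [L.Structure A]
    [Fintype A] (f : (Fin k → A) → ℕ) : Prop :=
  ∃ g : (i : Fin ψ.m) → (Fin (ψ.arity i) → A) → ℕ,
    (∀ i, ∑ a, g i a ≤ (∑ a, f a) * Fintype.card A ^ ψ.expo i) ∧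
      ψ.body.Holds (weightInterp f g) Fin.elim0

end MultiteamLogic

/-! A weight function is stored in the team as a set of flagged rows: the weight of a tuple `a` is
the number of rows whose flag equals a fixed mark and whose argument variables have the value `a`.
Mark and non-mark are two distinct elements. Universally quantified copy variables multiply the team
by powers of |A|, which leaves enough rows to guess every gᵢ within its bound |f|·|A|^ℓᵢ by
existentially quantified flags and arguments (`ESOmts.holds_iff_exists_guess`).

The value of a numeric term is then the number of pairs (row, auxiliary values) satisfying a
quantifier-free condition: a sum turns its bound variables into auxiliary ones, an addition is a
disjoint union separated by a tag (`NumTerm.exists_rowDefinable`). An equation becomes one inclusion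
atom, since two tuples read from the same team have multisets of equal size, so that inclusion is
equality.

Connectives cannot be translated literally: splitting the team, or choosing different witnesses in
different rows, would spoil the counts. Instead all first-order variables range over all values in
every row, and an activity flag depending only on these values tells for which tuples the formula
must still hold (`FOmts.exists_translates`). Disjunction guesses two flags that cover the given one;
an existential quantifier guesses a witness function and activates its graph. That guesses are
functions is expressed by dependence, which is definable from exclusion (`TeamDefinable.dep`).
Non-emptiness of the team ensures that every tuple occurs in some row. -/

namespace MultiteamLogic

/-! ### Multiteams presented as finite families of assignments -/

/-- The multiteam whose occurrences are the members of a finite family of assignments. -/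
noncomputable def fam {A : Type w} {n : ℕ} {ι : Type w} [Finite ι] (s : ι → Fin n → A) :
    Multiteam A n :=
  letI := Fintype.ofFinite ι
  (Finset.univ : Finset ι).val.map s

section fam

variable {A : Type w} {n : ℕ} {ι κ : Type w} [Finite ι] [Finite κ]

theorem fam_eq [Fintype ι] (s : ι → Fin n → A) :
    fam s = (Finset.univ : Finset ι).val.map s := by
  unfold fam
  congr!

theorem mem_fam {s : ι → Fin n → A} {x : Fin n → A} : x ∈ fam s ↔ ∃ i, s i = x := by
  simp [fam]

theorem fam_reindex (e : κ ≃ ι) (s : ι → Fin n → A) : fam (s ∘ e) = fam s := by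
  let := Fintype.ofFinite ι
  let := Fintype.ofFinite κ
  rw [fam_eq, fam_eq, ← Multiset.map_map]
  congr 1
  simp

theorem count_map_fam {β : Type w} [DecidableEq β] (s : ι → Fin n → A) (x : (Fin n → A) → β)
    (b : β) : ((fam s).map x).count b = Nat.card {i // x (s i) = b} := by
  classical
  let := Fintype.ofFinite ι
  rw [fam_eq, Multiset.map_map, Multiset.count_map, Nat.card_eq_fintype_card, Fintype.card_subtype,
    Finset.card_def, Finset.filter_val]
  simp [eq_comm]

theorem count_fam [DecidableEq A] (s : ι → Fin n → A) (b : Fin n → A) :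
    (fam s).count b = Nat.card {i // s i = b} := by
  simpa using count_map_fam s id b

theorem fam_toType [DecidableEq A] (M : Multiteam A n) :
    fam (fun p : M => (p.1 : Fin n → A)) = M := by
  rw [fam_eq]
  exact Multiset.map_univ_coe M

theorem univExt_fam [Fintype A] (s : ι → Fin n → A) :
    (fam s).univExt = fam fun p : ι × A => (Fin.snoc (s p.1) p.2 : Fin (n + 1) → A) := by
  let := Fintype.ofFinite ι
  rw [fam_eq, fam_eq, Multiteam.univExt, Multiset.bind_map, ← Finset.univ_product_univ,
    Finset.product_val]
  simp [SProd.sprod, Multiset.product, Multiset.map_bind]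

/-- Fibres over the same assignment have the same size, namely its multiplicity, and bijections
between the fibres glue together. -/
theorem exists_equiv_of_fam_eq {s : ι → Fin n → A} {t : κ → Fin n → A} (h : fam s = fam t) :
    ∃ e : ι ≃ κ, ∀ i, t (e i) = s i := by
  classical
  have f : ∀ a, Nonempty ({i // s i = a} ≃ {i // t i = a}) := fun a =>
    Finite.card_eq.1 (by rw [← count_fam, ← count_fam, h])
  refine ⟨(Equiv.sigmaFiberEquiv s).symm.trans
    ((Equiv.sigmaCongrRight fun a => (f a).some).trans (Equiv.sigmaFiberEquiv t)), fun i => ?_⟩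
  exact ((f (s i)).some ⟨i, rfl⟩).2

-- A bijection between `ι` and the occurrences in `fam s` carries choice functions over, so that any
-- index type may replace the canonical one.
open Classical in
theorem skolemExt_fam (s : ι → Fin n → A) (P : Multiteam A (n + 1) → Prop) :
    (∃ F : fam s → A, P ((fam s).skolemExt F)) ↔
      ∃ a : ι → A, P (fam fun i => (Fin.snoc (s i) (a i) : Fin (n + 1) → A)) := by
  obtain ⟨e, he⟩ := exists_equiv_of_fam_eq (fam_toType (fam s)).symm
  have key : ∀ F : fam s → A, (fam s).skolemExt F =
      fam fun i => (Fin.snoc (s i) (F (e i)) : Fin (n + 1) → A) := by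
    intro F
    rw [Multiteam.skolemExt, ← fam_eq, ← fam_reindex e]
    congr 1
    funext i
    simp [he]
  constructor
  · rintro ⟨F, hF⟩
    exact ⟨F ∘ e, by rwa [key] at hF⟩
  · rintro ⟨a, ha⟩
    exact ⟨a ∘ e.symm, by rw [key]; simpa using ha⟩

end fam

/-! ### Blocks of quantifiers -/

section blocks

variable {L : FirstOrder.Language.{u, v}}

/-- Existential quantification of the `K` last variables. -/
def FOM.exs {n : ℕ} : (K : ℕ) → FOM L (n + K) → FOM L n
  | 0, φ => φ
  | K + 1, φ => FOM.exs K (FOM.ex φ)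

/-- Universal quantification of the `K` last variables. -/
def FOM.alls {n : ℕ} : (K : ℕ) → FOM L (n + K) → FOM L n
  | 0, φ => φ
  | K + 1, φ => FOM.alls K (FOM.all φ)

variable {A : Type w} [L.Structure A] [Fintype A] {n : ℕ} {ι κ : Type w} [Finite ι] [Finite κ]

theorem FOM.sat_ex_fam (φ : FOM L (n + 1)) (s : ι → Fin n → A) :
    (FOM.ex φ).Sat (fam s) ↔
      ∃ a : ι → A, φ.Sat (fam fun i => (Fin.snoc (s i) (a i) : Fin (n + 1) → A)) :=
  skolemExt_fam s fun M => φ.Sat M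

theorem FOM.sat_all_fam (φ : FOM L (n + 1)) (s : ι → Fin n → A) :
    (FOM.all φ).Sat (fam s) ↔
      φ.Sat (fam fun p : ι × A => (Fin.snoc (s p.1) p.2 : Fin (n + 1) → A)) := by
  rw [← univExt_fam]
  rfl

theorem FOM.sat_exs_fam (K : ℕ) (φ : FOM L (n + K)) (s : ι → Fin n → A) :
    (FOM.exs K φ).Sat (fam s) ↔
      ∃ b : ι → Fin K → A, φ.Sat (fam fun i => Fin.append (s i) (b i)) := by
  induction K with
  | zero =>
    have (b : ι → Fin 0 → A) : (fun i => Fin.append (s i) (b i)) = s := by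
      funext i
      rw [Subsingleton.elim (b i) Fin.elim0, Fin.append_elim0]
      rfl
    simp only [this, FOM.exs, exists_const]
  | succ K ih =>
    rw [FOM.exs, ih]
    simp only [FOM.sat_ex_fam, ← Fin.append_snoc]
    constructor
    · rintro ⟨b, a, h⟩
      exact ⟨fun i => Fin.snoc (b i) (a i), h⟩
    · rintro ⟨b, h⟩
      exact ⟨fun i => Fin.init (b i), fun i => b i (Fin.last K), by simpa using h⟩

theorem FOM.sat_alls_fam (K : ℕ) (φ : FOM L (n + K)) (s : ι → Fin n → A) :
    (FOM.alls K φ).Sat (fam s) ↔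
      φ.Sat (fam fun p : ι × (Fin K → A) => Fin.append (s p.1) p.2) := by
  induction K with
  | zero =>
    rw [FOM.alls, ← fam_reindex (Equiv.prodUnique ι (Fin 0 → A))]
    refine iff_of_eq (congrArg φ.Sat (congrArg fam ?_))
    funext p
    rw [Subsingleton.elim p.2 Fin.elim0, Fin.append_elim0]
    rfl
  | succ K ih =>
    rw [FOM.alls, ih, FOM.sat_all_fam]
    let e : (ι × (Fin K → A)) × A ≃ ι × (Fin (K + 1) → A) :=
      (Equiv.prodAssoc _ _ _).trans (Equiv.prodCongr (Equiv.refl ι)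
        ((Equiv.prodComm _ _).trans (Fin.snocEquiv fun _ => A)))
    rw [← fam_reindex e]
    refine iff_of_eq (congrArg φ.Sat (congrArg fam ?_))
    funext p
    rw [← Fin.append_snoc]
    rfl

end blocks

/-! ### Definable row conditions and team conditions -/

/-- Finite structures with at least two elements. -/
structure FinStr (L : FirstOrder.Language.{u, v}) where
  Carrier : Type w
  [str : L.Structure Carrier]
  [fintype : Fintype Carrier]
  [nontrivial : Nontrivial Carrier]

namespace FinStr

instance (L : FirstOrder.Language.{u, v}) : CoeSort (FinStr.{u, v, w} L) (Type w) := ⟨Carrier⟩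

attribute [instance] FinStr.str FinStr.fintype FinStr.nontrivial

end FinStr

variable {L : FirstOrder.Language.{u, v}}

/-- A condition on an assignment of the variables `V`, uniformly for all finite structures. -/
abbrev RowCond (L : FirstOrder.Language.{u, v}) (V : Type) :=
  ∀ 𝔄 : FinStr.{u, v, w} L, (V → 𝔄) → Prop

/-- A condition on a finite family of assignments of the variables `V`, uniformly for all finite
structures. -/
abbrev TeamCond (L : FirstOrder.Language.{u, v}) (V : Type) :=
  ∀ (𝔄 : FinStr.{u, v, w} L) (ι : Type w) [Finite ι], (ι → V → 𝔄) → Prop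

/-- Some formula expresses, however the variables `V` are named, that each row satisfies `θ`. -/
def FlatDefinable {V : Type} (θ : RowCond.{u, v, w} L V) : Prop :=
  ∀ (n : ℕ) (e : V → Fin n), ∃ φ : FOM L n, ∀ (𝔄 : FinStr.{u, v, w} L) (M : Multiteam 𝔄 n),
    φ.Sat M ↔ ∀ s ∈ M, θ 𝔄 (s ∘ e)

/-- Both `θ` and its negation are expressible row by row. -/
def RowDefinable {V : Type} (θ : RowCond.{u, v, w} L V) : Prop :=
  FlatDefinable θ ∧ FlatDefinable fun 𝔄 s => ¬ θ 𝔄 s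

/-- Some formula expresses `P`, however the variables `V` are named. -/
def TeamDefinable {V : Type} (P : TeamCond.{u, v, w} L V) : Prop :=
  ∀ (n : ℕ) (e : V → Fin n), ∃ φ : FOM L n, ∀ (𝔄 : FinStr.{u, v, w} L) (ι : Type w) [Finite ι]
    (s : ι → Fin n → 𝔄), φ.Sat (fam s) ↔ P 𝔄 ι fun i => s i ∘ e

/-! ### Conditions tested row by row -/

section row

variable {V V' : Type} {θ η : RowCond.{u, v, w} L V}

theorem FlatDefinable.congr (h : FlatDefinable θ) (e : ∀ 𝔄 s, θ 𝔄 s ↔ η 𝔄 s) :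
    FlatDefinable η := by
  have : θ = η := by
    funext 𝔄 s
    exact propext (e 𝔄 s)
  exact this ▸ h

theorem FlatDefinable.and (hθ : FlatDefinable θ) (hη : FlatDefinable η) :
    FlatDefinable fun 𝔄 s => θ 𝔄 s ∧ η 𝔄 s := by
  intro n e
  obtain ⟨φ, hφ⟩ := hθ n e
  obtain ⟨χ, hχ⟩ := hη n e
  refine ⟨.and φ χ, fun 𝔄 M => ?_⟩
  rw [FOM.Sat, hφ, hχ]
  exact forall₂_and.symm

theorem FlatDefinable.or (hθ : FlatDefinable θ) (hη : FlatDefinable η) :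
    FlatDefinable fun 𝔄 s => θ 𝔄 s ∨ η 𝔄 s := by
  classical
  intro n e
  obtain ⟨φ, hφ⟩ := hθ n e
  obtain ⟨χ, hχ⟩ := hη n e
  refine ⟨.or φ χ, fun 𝔄 M => ?_⟩
  rw [FOM.Sat]
  constructor
  · rintro ⟨M₁, M₂, rfl, h₁, h₂⟩ s hs
    rcases Multiset.mem_add.1 hs with hs | hs
    · exact Or.inl ((hφ _ _).1 h₁ s hs)
    · exact Or.inr ((hχ _ _).1 h₂ s hs)
  · intro h
    refine ⟨M.filter fun s => θ 𝔄 (s ∘ e), M.filter fun s => ¬ θ 𝔄 (s ∘ e),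
      Multiset.filter_add_not _ M, (hφ _ _).2 fun s hs => (Multiset.mem_filter.1 hs).2,
      (hχ _ _).2 fun s hs => ?_⟩
    obtain ⟨h₁, h₂⟩ := Multiset.mem_filter.1 hs
    exact (h s h₁).resolve_left h₂

theorem RowDefinable.congr (h : RowDefinable θ) (e : ∀ 𝔄 s, θ 𝔄 s ↔ η 𝔄 s) :
    RowDefinable η := by
  have : θ = η := by
    funext 𝔄 s
    exact propext (e 𝔄 s)
  exact this ▸ h

theorem RowDefinable.not (h : RowDefinable θ) : RowDefinable fun 𝔄 s => ¬ θ 𝔄 s :=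
  ⟨h.2, h.1.congr fun _ _ => not_not.symm⟩

theorem RowDefinable.and (hθ : RowDefinable θ) (hη : RowDefinable η) :
    RowDefinable fun 𝔄 s => θ 𝔄 s ∧ η 𝔄 s :=
  ⟨hθ.1.and hη.1, (hθ.2.or hη.2).congr fun _ _ => not_and_or.symm⟩

theorem RowDefinable.or (hθ : RowDefinable θ) (hη : RowDefinable η) :
    RowDefinable fun 𝔄 s => θ 𝔄 s ∨ η 𝔄 s :=
  ⟨hθ.1.or hη.1, (hθ.2.and hη.2).congr fun _ _ => not_or.symm⟩

theorem RowDefinable.imp (hθ : RowDefinable θ) (hη : RowDefinable η) :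
    RowDefinable fun 𝔄 s => θ 𝔄 s → η 𝔄 s :=
  (hθ.not.or hη).congr fun _ _ => imp_iff_not_or.symm

theorem RowDefinable.iff (hθ : RowDefinable θ) (hη : RowDefinable η) :
    RowDefinable fun 𝔄 s => (θ 𝔄 s ↔ η 𝔄 s) :=
  ((hθ.imp hη).and (hη.imp hθ)).congr fun _ _ => iff_iff_implies_and_implies.symm

/-- Empty tuples are always equal, so inclusion between them is always true, and exclusion holds
only in the empty team. -/
theorem RowDefinable.true : RowDefinable fun (_ : FinStr.{u, v, w} L) (_ : V → _) => True := by
  refine ⟨fun n _ => ⟨.incl (l := 0) Fin.elim0 Fin.elim0, fun 𝔄 M => ?_⟩,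
    fun n _ => ⟨.excl (l := 0) Fin.elim0 Fin.elim0, fun 𝔄 M => ?_⟩⟩
  · simp [FOM.Sat]
  · simp only [FOM.Sat]
    exact ⟨fun h s hs => absurd rfl (h s hs s hs), fun h s hs => absurd trivial (h s hs)⟩

theorem RowDefinable.forall {B : Type} [Finite B] {θ : B → RowCond.{u, v, w} L V}
    (h : ∀ b, RowDefinable (θ b)) : RowDefinable fun 𝔄 s => ∀ b, θ b 𝔄 s := by
  classical
  let := Fintype.ofFinite B
  have : ∀ T : Finset B, RowDefinable fun 𝔄 s => ∀ b ∈ T, θ b 𝔄 s := by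
    intro T
    induction T using Finset.induction_on with
    | empty => exact RowDefinable.true.congr fun _ _ => by simp
    | insert b T _ ih => exact ((h b).and ih).congr fun _ _ => by simp
  exact (this Finset.univ).congr fun _ _ => by simp

theorem RowDefinable.lit {n : ℕ} (α : Literal L n) (x : Fin n → V) :
    RowDefinable fun (𝔄 : FinStr.{u, v, w} L) (s : V → 𝔄) => α.Holds (s ∘ x) := by
  cases α with
  | eq i j =>
    exact ⟨fun n e => ⟨.lit (.eq (e (x i)) (e (x j))), fun _ _ => Iff.rfl⟩,
      fun n e => ⟨.lit (.ne (e (x i)) (e (x j))), fun _ _ => Iff.rfl⟩⟩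
  | ne i j =>
    exact ⟨fun n e => ⟨.lit (.ne (e (x i)) (e (x j))), fun _ _ => Iff.rfl⟩,
      FlatDefinable.congr (fun n e => ⟨.lit (.eq (e (x i)) (e (x j))), fun _ _ => Iff.rfl⟩)
        (θ := fun 𝔄 s => s (x i) = s (x j)) fun _ _ => not_not.symm⟩
  | rel R y =>
    exact ⟨fun n e => ⟨.lit (.rel R (e ∘ x ∘ y)), fun _ _ => Iff.rfl⟩,
      fun n e => ⟨.lit (.nrel R (e ∘ x ∘ y)), fun _ _ => Iff.rfl⟩⟩
  | nrel R y =>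
    exact ⟨fun n e => ⟨.lit (.nrel R (e ∘ x ∘ y)), fun _ _ => Iff.rfl⟩,
      FlatDefinable.congr (fun n e => ⟨.lit (.rel R (e ∘ x ∘ y)), fun _ _ => Iff.rfl⟩)
        (θ := fun 𝔄 s => FirstOrder.Language.Structure.RelMap R (s ∘ x ∘ y))
        fun _ _ => not_not.symm⟩

theorem RowDefinable.eq (x y : V) :
    RowDefinable fun (𝔄 : FinStr.{u, v, w} L) (s : V → 𝔄) => s x = s y :=
  RowDefinable.lit (.eq 0 1) ![x, y]

theorem RowDefinable.rename (h : RowDefinable θ) (σ : V → V') :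
    RowDefinable fun 𝔄 (s : V' → 𝔄) => θ 𝔄 (s ∘ σ) :=
  ⟨fun n e => h.1 n (e ∘ σ), fun n e => h.2 n (e ∘ σ)⟩

end row

/-! ### Conditions on whole teams -/

section team

variable {V V' : Type} {P Q : TeamCond.{u, v, w} L V}

theorem RowDefinable.team {θ : RowCond.{u, v, w} L V} (h : RowDefinable θ) :
    TeamDefinable fun 𝔄 ι _ (s : ι → V → 𝔄) => ∀ i, θ 𝔄 (s i) := by
  intro n e
  obtain ⟨φ, hφ⟩ := h.1 n e
  refine ⟨φ, fun 𝔄 ι _ s => ?_⟩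
  rw [hφ]
  simp [mem_fam]

theorem TeamDefinable.rename (h : TeamDefinable P) (σ : V → V') :
    TeamDefinable fun 𝔄 ι _ (s : ι → V' → 𝔄) => P 𝔄 ι fun i => s i ∘ σ :=
  fun n e => h n (e ∘ σ)

theorem TeamDefinable.and (hP : TeamDefinable P) (hQ : TeamDefinable Q) :
    TeamDefinable fun 𝔄 ι _ (s : ι → V → 𝔄) => P 𝔄 ι s ∧ Q 𝔄 ι s := by
  intro n e
  obtain ⟨φ, hφ⟩ := hP n e
  obtain ⟨χ, hχ⟩ := hQ n e
  exact ⟨.and φ χ, fun 𝔄 ι _ s => and_congr (hφ 𝔄 ι s) (hχ 𝔄 ι s)⟩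

theorem TeamDefinable.exists {B : Type} [Fintype B] {P : TeamCond.{u, v, w} L (V ⊕ B)}
    (h : TeamDefinable P) :
    TeamDefinable fun 𝔄 ι _ (s : ι → V → 𝔄) =>
      ∃ b : ι → B → 𝔄, P 𝔄 ι fun i => Sum.elim (s i) (b i) := by
  intro n e
  let E := Fintype.equivFin B
  obtain ⟨φ, hφ⟩ := h (n + Fintype.card B)
    (Sum.elim (Fin.castAdd _ ∘ e) (Fin.natAdd n ∘ E))
  refine ⟨.exs _ φ, fun 𝔄 ι _ s => ?_⟩
  have key : ∀ b : ι → Fin (Fintype.card B) → 𝔄,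
      (fun i => (Fin.append (s i) (b i)) ∘ Sum.elim (Fin.castAdd _ ∘ e) (Fin.natAdd n ∘ E)) =
        fun i => Sum.elim (s i ∘ e) (b i ∘ E) := by
    intro b
    funext i x
    cases x <;> simp
  simp only [FOM.sat_exs_fam, hφ, key]
  constructor
  · rintro ⟨b, hb⟩
    exact ⟨fun i => b i ∘ E, hb⟩
  · rintro ⟨b, hb⟩
    refine ⟨fun i => b i ∘ E.symm, ?_⟩
    simpa [Function.comp_assoc] using hb

/-- A definable condition depends only on the multiteam that a family presents. -/
theorem TeamDefinable.reindex [Finite V] (h : TeamDefinable P) (𝔄 : FinStr.{u, v, w} L)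
    {ι κ : Type w} [Finite ι] [Finite κ] (e : κ ≃ ι) (s : ι → V → 𝔄) :
    P 𝔄 κ (fun i => s (e i)) ↔ P 𝔄 ι s := by
  obtain ⟨n, ⟨E⟩⟩ := Finite.exists_equiv_fin V
  obtain ⟨φ, hφ⟩ := h n E
  have h₁ := hφ 𝔄 ι fun i => s i ∘ E.symm
  have h₂ := hφ 𝔄 κ fun i => s (e i) ∘ E.symm
  rw [show (fun i => s (e i) ∘ E.symm) = (fun i => s i ∘ E.symm) ∘ e from rfl, fam_reindex] at h₂
  simp only [Function.comp_assoc, Equiv.symm_comp_self, Function.comp_id]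
    at h₁ h₂
  exact h₂.symm.trans h₁

/-- The formula quantifies over tuples indexed by `Fin`; invariance under reindexing exchanges them
for functions on `B`. -/
theorem TeamDefinable.forall {B : Type} [Fintype B] {P : TeamCond.{u, v, w} L (V ⊕ B)}
    [Finite V] (h : TeamDefinable P) :
    TeamDefinable fun 𝔄 ι _ (s : ι → V → 𝔄) =>
      P 𝔄 (ι × (B → 𝔄)) fun p => Sum.elim (s p.1) p.2 := by
  intro n e
  let E := Fintype.equivFin B
  obtain ⟨φ, hφ⟩ := h (n + Fintype.card B)
    (Sum.elim (Fin.castAdd _ ∘ e) (Fin.natAdd n ∘ E))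
  refine ⟨.alls _ φ, fun 𝔄 ι _ s => ?_⟩
  rw [FOM.sat_alls_fam, hφ, ← h.reindex 𝔄
    (Equiv.prodCongr (Equiv.refl ι) (Equiv.arrowCongr E (Equiv.refl 𝔄)))]
  refine iff_of_eq (congrArg (P 𝔄 _) ?_)
  funext p x
  cases x <;> simp [Equiv.arrowCongr]

/-- The value of `y` is a function of the values of `x`. -/
theorem TeamDefinable.dep {l : ℕ} (x : Fin l → V) (y : V) :
    TeamDefinable fun (𝔄 : FinStr.{u, v, w} L) ι _ (s : ι → V → 𝔄) =>
      ∀ i j, s i ∘ x = s j ∘ x → s i y = s j y := by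
  classical
  intro n e
  let x' : Fin l → Fin (n + 1) := fun i => (e (x i)).castSucc
  -- The formula is ∀z (z = y ∨ xz | xy). Rows with z ≠ y must go to the right, where the atom
  -- forbids that z is the value of y in another such row with the same x.
  refine ⟨.all (.or (.lit (.eq (Fin.last n) (e y).castSucc))
    (.excl (Fin.snoc x' (Fin.last n)) (Fin.snoc x' (e y).castSucc))), fun 𝔄 ι _ s => ?_⟩
  rw [FOM.sat_all_fam]
  have hx : ∀ (r : Fin n → 𝔄) (a : 𝔄) (z : Fin (n + 1)),
      (Fin.snoc r a : Fin (n + 1) → 𝔄) ∘ (Fin.snoc x' z : Fin (l + 1) → Fin (n + 1)) =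
        (Fin.snoc (r ∘ e ∘ x) ((Fin.snoc r a : Fin (n + 1) → 𝔄) z) : Fin (l + 1) → 𝔄) := by
    intro r a z
    funext i
    refine Fin.lastCases ?_ (fun i => ?_) i <;> simp [x']
  simp only [FOM.Sat, Literal.Holds]
  constructor
  · rintro ⟨M₁, M₂, h, h₁, h₂⟩ i j hij
    by_contra hne
    have mem : ∀ i a, a ≠ s i (e y) → (Fin.snoc (s i) a : Fin (n + 1) → 𝔄) ∈ M₂ := by
      intro i a ha
      have : (Fin.snoc (s i) a : Fin (n + 1) → 𝔄) ∈ M₁ + M₂ := by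
        rw [h]
        exact mem_fam.2 ⟨(i, a), rfl⟩
      rcases Multiset.mem_add.1 this with h | h
      · have := h₁ _ h
        simp only [Fin.snoc_last, Fin.snoc_castSucc] at this
        exact absurd this ha
      · exact h
    -- Row `j` must also occur on the exclusion side; any value other than its own `y` brings it
    -- there.
    obtain ⟨a, ha⟩ := exists_ne (s j (e y))
    refine h₂ _ (mem i (s j (e y)) fun h => hne h.symm) _ (mem j a ha) ?_
    rw [hx, hx]
    simp only [Fin.snoc_last, Fin.snoc_castSucc]
    exact congrArg (fun r => (Fin.snoc r _ : Fin (l + 1) → 𝔄)) hij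
  · intro h
    set N := fam fun p : ι × 𝔄 => (Fin.snoc (s p.1) p.2 : Fin (n + 1) → 𝔄)
    let θ : (Fin (n + 1) → 𝔄) → Prop := fun r => r (Fin.last n) = r (e y).castSucc
    refine ⟨N.filter θ, N.filter fun r => ¬ θ r, Multiset.filter_add_not _ N,
      fun r hr => (Multiset.mem_filter.1 hr).2, fun r hr r' hr' heq => ?_⟩
    obtain ⟨hr, hθ⟩ := Multiset.mem_filter.1 hr
    obtain ⟨hr', -⟩ := Multiset.mem_filter.1 hr'
    obtain ⟨⟨i, a⟩, rfl⟩ := mem_fam.1 hr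
    obtain ⟨⟨j, b⟩, rfl⟩ := mem_fam.1 hr'
    rw [hx, hx] at heq
    obtain ⟨h₁, h₂⟩ := Fin.snoc_inj.1 heq
    simp only [Fin.snoc_last, Fin.snoc_castSucc, θ] at h₂ hθ
    exact hθ (h₂.trans (h i j h₁).symm)

/-- Two tuples of variables have the same multiset of values. -/
theorem TeamDefinable.equidistributed {W : Type} [Fintype W] (x y : W → V) :
    TeamDefinable fun (𝔄 : FinStr.{u, v, w} L) ι _ (s : ι → V → 𝔄) =>
      ∀ a : W → 𝔄, Nat.card {i // s i ∘ x = a} = Nat.card {i // s i ∘ y = a} := by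
  classical
  intro n e
  let E := Fintype.equivFin W
  refine ⟨.incl (e ∘ x ∘ E.symm) (e ∘ y ∘ E.symm), fun 𝔄 ι _ s => ?_⟩
  have key : ∀ (x : W → V) (a : Fin (Fintype.card W) → 𝔄),
      ((fam s).map fun s => s ∘ e ∘ x ∘ E.symm).count a =
        Nat.card {i // (s i ∘ e) ∘ x = a ∘ E} := by
    intro x a
    rw [count_map_fam]
    refine Nat.card_congr (Equiv.subtypeEquivRight fun i => ?_)
    rw [← E.comp_symm_eq]
    rfl
  rw [FOM.Sat]
  constructor
  · intro h a
    -- Both multisets have one element per row, so inclusion forces equality.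
    have := Multiset.eq_of_le_of_card_le h (by simp)
    have h₂ := congrArg (Multiset.count (a ∘ E.symm)) this
    rw [key, key] at h₂
    simpa [Function.comp_assoc] using h₂
  · intro h
    refine le_of_eq (Multiset.ext.2 fun a => ?_)
    rw [key, key]
    exact h _

end team

/-! ### Counting the rows that satisfy a condition -/

/-- Adding variables whose values are prescribed does not change the number of solutions. -/
theorem card_pad {ι A : Type w} {B B' : Type} {j : B → B'} (hj : j.Injective)
    (Q : ι → (B → A) → Prop) (k : ι → B' → A) :
    Nat.card {p : ι × (B' → A) //
      Q p.1 (p.2 ∘ j) ∧ ∀ b : {b // b ∉ Set.range j}, p.2 b = k p.1 b} =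
      Nat.card {p : ι × (B → A) // Q p.1 p.2} := by
  refine Nat.card_eq_of_bijective (fun p => ⟨(p.1.1, p.1.2 ∘ j), p.2.1⟩) ⟨?_, ?_⟩
  · rintro ⟨⟨i, b⟩, h, hb⟩ ⟨⟨i', b'⟩, h', hb'⟩ heq
    simp only [Subtype.mk.injEq, Prod.mk.injEq] at heq
    obtain ⟨rfl, heq⟩ := heq
    simp only [Subtype.mk.injEq, Prod.mk.injEq, true_and]
    funext x
    by_cases hx : x ∈ Set.range j
    · obtain ⟨y, rfl⟩ := hx
      exact congrFun heq y
    · exact (hb ⟨x, hx⟩).trans (hb' ⟨x, hx⟩).symm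
  · rintro ⟨⟨i, b⟩, h⟩
    have hb : Function.extend j b (k i) ∘ j = b := funext fun x => hj.extend_apply _ _ x
    refine ⟨⟨(i, Function.extend j b (k i)), ?_, fun x => ?_⟩, ?_⟩
    · simpa only [hb] using h
    · exact Function.extend_apply' _ _ _ x.2
    · simp only [hb]

theorem card_or {α : Type w} [Finite α] {p q : α → Prop} (h : ∀ a, p a → ¬ q a) :
    Nat.card {a // p a ∨ q a} = Nat.card {a // p a} + Nat.card {a // q a} := by
  classical
  rw [← Nat.card_sum]
  exact Nat.card_congr (subtypeOrEquiv p q (Pi.disjoint_iff.2 fun a => by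
    simpa [Prop.disjoint_iff, not_and] using h a))

/-- The condition `θ` on the variables in the range of `j`, the others having the values of given
variables. -/
def RowCond.pad {V B B' : Type} (θ : RowCond.{u, v, w} L (V ⊕ B)) (j : B → B') (k : B' → V) :
    RowCond.{u, v, w} L (V ⊕ B') := fun 𝔄 r =>
  θ 𝔄 (r ∘ Sum.map id j) ∧ ∀ b : {b // b ∉ Set.range j}, r (.inr b) = r (.inl (k b))

theorem RowDefinable.pad {V B B' : Type} [Finite B'] {θ : RowCond.{u, v, w} L (V ⊕ B)}
    (h : RowDefinable θ) (j : B → B') (k : B' → V) : RowDefinable (θ.pad j k) :=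
  (h.rename _).and (.forall fun _ => .eq _ _)

theorem RowCond.card_pad {V B B' : Type} (θ : RowCond.{u, v, w} L (V ⊕ B)) {j : B → B'}
    (hj : j.Injective) (k : B' → V) (𝔄 : FinStr.{u, v, w} L) {ι : Type w} (s : ι → V → 𝔄) :
    Nat.card {p : ι × (B' → 𝔄) // θ.pad j k 𝔄 (Sum.elim (s p.1) p.2)} =
      Nat.card {p : ι × (B → 𝔄) // θ 𝔄 (Sum.elim (s p.1) p.2)} := by
  rw [← MultiteamLogic.card_pad hj (fun i b => θ 𝔄 (Sum.elim (s i) b)) fun i b => s i (k b)]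
  simp only [RowCond.pad, Sum.elim_comp_map, Function.comp_id, Sum.elim_inr, Sum.elim_inl]

/-! ### Numeric terms as numbers of solutions -/

section terms

variable {W V : Type} {ar : W → ℕ}

/-- The weights that a family of rows gives to the tuples `arg g` where `flag g` is raised. -/
noncomputable def weights {ι A : Type w} (flag : W → V) (arg : (g : W) → Fin (ar g) → V)
    (s : ι → V → A) (c : A) (g : W) (a : Fin (ar g) → A) : ℕ :=
  Nat.card {i // s i (flag g) = c ∧ s i ∘ arg g = a}

/-- The value of a numeric term is the number of solutions of a definable condition. -/
theorem NumTerm.exists_rowDefinable (c d : V) (flag : W → V) (arg : (g : W) → Fin (ar g) → V)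
    {n : ℕ} (t : NumTerm L W ar n) :
    ∃ (B : Type) (_ : Fintype B) (θ : RowCond.{u, v, w} L ((V ⊕ Fin n) ⊕ B)), RowDefinable θ ∧
      ∀ (𝔄 : FinStr.{u, v, w} L) (ι : Type w) [Finite ι] (s : ι → V → 𝔄) (c₀ : 𝔄),
        (∀ i, s i c = c₀) → (∀ i, s i d ≠ c₀) → ∀ u : Fin n → 𝔄,
          t.val (weights flag arg s c₀) u =
            Nat.card {p : ι × (B → 𝔄) // θ 𝔄 (Sum.elim (Sum.elim (s p.1) u) p.2)} := by
  induction t with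
  | zero =>
    exact ⟨Empty, inferInstance, _, RowDefinable.true.not, fun 𝔄 ι _ s c₀ _ _ u => by
      simp [NumTerm.val]⟩
  | app g x =>
    refine ⟨Empty, inferInstance, _, (RowDefinable.eq (.inl (.inl (flag g))) (.inl (.inl c))).and
      (.forall fun k => .eq (.inl (.inl (arg g k))) (.inl (.inr (x k)))),
      fun 𝔄 ι _ s c₀ hc _ u => ?_⟩
    rw [NumTerm.val, weights]
    refine Nat.card_congr (((Equiv.prodUnique ι (Empty → 𝔄)).symm).subtypeEquiv fun i => ?_)
    simp [hc, funext_iff]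
  | @add n t t' ih ih' =>
    obtain ⟨B, _, θ, hθ, h⟩ := ih
    obtain ⟨B', _, θ', hθ', h'⟩ := ih'
    -- The variable `none` is a tag outside both ranges: padding gives it the value of `c` in the
    -- first condition and of `d` in the second, which makes the solution sets disjoint. The other
    -- idle variables are fixed at `c`, so that they do not multiply solutions.
    let k (e : V) : Option (B ⊕ B') → V ⊕ Fin n := fun o => o.elim (.inl e) fun _ => .inl c
    let j : B → Option (B ⊕ B') := fun b => some (.inl b)
    let j' : B' → Option (B ⊕ B') := fun b => some (.inr b)
    have hj : j.Injective := (Option.some_injective _).comp Sum.inl_injective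
    have hj' : j'.Injective := (Option.some_injective _).comp Sum.inr_injective
    refine ⟨Option (B ⊕ B'), inferInstance, _, (hθ.pad j (k c)).or (hθ'.pad j' (k d)),
      fun 𝔄 ι _ s c₀ hc hd u => ?_⟩
    rw [NumTerm.val, h 𝔄 ι s c₀ hc hd u, h' 𝔄 ι s c₀ hc hd u, card_or]
    · rw [RowCond.card_pad θ hj (k c) 𝔄 fun i => Sum.elim (s i) u,
        RowCond.card_pad θ' hj' (k d) 𝔄 fun i => Sum.elim (s i) u]
    · rintro ⟨i, b⟩ ⟨-, h₁⟩ ⟨-, h₂⟩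
      have h₁ := h₁ ⟨none, by simp [j]⟩
      have h₂ := h₂ ⟨none, by simp [j']⟩
      simp only [Sum.elim_inr, Sum.elim_inl, k, Option.elim_none] at h₁ h₂
      exact hd i (by rw [← h₂, h₁, hc])
  | @sum n l t α ih =>
    obtain ⟨B, _, θ, hθ, h⟩ := ih
    let x : Fin (n + l) → (V ⊕ Fin n) ⊕ (Fin l ⊕ B) :=
      Fin.append (fun i => .inl (.inr i)) fun i => .inr (.inl i)
    let σ : (V ⊕ Fin (n + l)) ⊕ B → (V ⊕ Fin n) ⊕ (Fin l ⊕ B) :=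
      Sum.elim (Sum.elim (fun v => .inl (.inl v)) x) fun b => .inr (.inr b)
    have hα : RowDefinable fun (𝔄 : FinStr.{u, v, w} L) (r : (V ⊕ Fin n) ⊕ (Fin l ⊕ B) → 𝔄) =>
        ∀ β ∈ α, β.Holds (r ∘ x) := by
      cases α with
      | none => exact RowDefinable.true.congr fun _ _ => by simp
      | some α => exact (RowDefinable.lit α x).congr fun _ _ => by simp
    refine ⟨Fin l ⊕ B, inferInstance, _, hα.and (hθ.rename σ), fun 𝔄 ι _ s c₀ hc hd u => ?_⟩
    have hx : ∀ (i : ι) (b : Fin l → 𝔄) (b' : B → 𝔄),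
        Sum.elim (Sum.elim (s i) u) (Sum.elim b b') ∘ x = Fin.append u b := by
      intro i b b'
      funext z
      refine Fin.addCases (fun z => ?_) (fun z => ?_) z <;> simp [x]
    have hσ : ∀ (i : ι) (b : Fin l → 𝔄) (b' : B → 𝔄),
        Sum.elim (Sum.elim (s i) u) (Sum.elim b b') ∘ σ =
          Sum.elim (Sum.elim (s i) (Fin.append u b)) b' := by
      intro i b b'
      rw [← hx i b b']
      funext z
      rcases z with (z | z) | z <;> simp [σ]
    classical
    rw [NumTerm.val]
    have : ∀ b : Fin l → 𝔄, (if ∀ β ∈ α, β.Holds (Fin.append u b) then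
        t.val (weights flag arg s c₀) (Fin.append u b) else 0) =
          Nat.card {p : ι × (B → 𝔄) // (∀ β ∈ α, β.Holds (Fin.append u b)) ∧
            θ 𝔄 (Sum.elim (Sum.elim (s p.1) (Fin.append u b)) p.2)} := by
      intro b
      split_ifs with hb
      · rw [h 𝔄 ι s c₀ hc hd]
        exact Nat.card_congr (Equiv.subtypeEquivRight fun p => (and_iff_right hb).symm)
      · have : IsEmpty {p : ι × (B → 𝔄) // (∀ β ∈ α, β.Holds (Fin.append u b)) ∧
            θ 𝔄 (Sum.elim (Sum.elim (s p.1) (Fin.append u b)) p.2)} := ⟨fun p => hb p.2.1⟩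
        rw [Nat.card_of_isEmpty]
    refine Eq.trans (Finset.sum_congr rfl fun b _ => ?_) (Eq.trans Nat.card_sigma.symm
      (Nat.card_congr (α := Σ b : Fin l → 𝔄, {p : ι × (B → 𝔄) //
        (∀ β ∈ α, β.Holds (Fin.append u b)) ∧
          θ 𝔄 (Sum.elim (Sum.elim (s p.1) (Fin.append u b)) p.2)}) ?_))
    · convert this b
    · exact
        { toFun := fun p => ⟨(p.2.1.1, Sum.elim p.1 p.2.1.2), by
            simpa only [hx, hσ] using p.2.2⟩
          invFun := fun p => ⟨p.1.2 ∘ Sum.inl, (p.1.1, p.1.2 ∘ Sum.inr), by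
            have := p.2
            rw [← Sum.elim_comp_inl_inr p.1.2] at this
            simpa only [hx, hσ] using this⟩
          left_inv := fun p => rfl
          right_inv := fun p => Subtype.ext (Prod.ext rfl (Sum.elim_comp_inl_inr _)) }

end terms

/-! ### Translation of formulae -/

/-- Within a fibre the rows labelled `d` are the complement of those labelled `c`, so equal numbers
of the latter give equal numbers of the former; other labels do not occur. -/
theorem card_ite_eq {κ A T : Type w} [Finite κ] {c d : A} (hcd : d ≠ c) (U : κ → T)
    (l l' : κ → Prop) [DecidablePred l] [DecidablePred l']
    (h : ∀ u, Nat.card {i // U i = u ∧ l i} = Nat.card {i // U i = u ∧ l' i}) (u : T) (a : A) :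
    Nat.card {i // U i = u ∧ (if l i then c else d) = a} =
      Nat.card {i // U i = u ∧ (if l' i then c else d) = a} := by
  have key : ∀ l : κ → Prop, Nat.card {i // U i = u} =
      Nat.card {i // U i = u ∧ l i} + Nat.card {i // U i = u ∧ ¬ l i} := by
    intro l
    rw [← card_or fun i h₁ h₂ => h₂.2 h₁.2]
    exact Nat.card_congr (Equiv.subtypeEquivRight fun i => by tauto)
  have eqc : ∀ (l : κ → Prop) [DecidablePred l] i, (if l i then c else d) = c ↔ l i := by
    intro l _ i
    split_ifs with hi <;> simp [hi, hcd]
  have eqd : ∀ (l : κ → Prop) [DecidablePred l] i, (if l i then c else d) = d ↔ ¬ l i := by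
    intro l _ i
    split_ifs with hi <;> simp [hi, hcd.symm]
  by_cases hc : a = c
  · simp only [hc, eqc, h]
  by_cases hd : a = d
  · simp only [hd, eqd]
    have h₁ := key l
    have h₂ := key l'
    have h₃ := h u
    omega
  · have ne : ∀ (l : κ → Prop) [DecidablePred l] i, ¬ (if l i then c else d) = a := by
      intro l _ i
      split_ifs
      exacts [Ne.symm hc, Ne.symm hd]
    simp only [ne, and_false]

/-- Each tuple `u` is paired with all of `ι`, so counting above a fixed `u` recovers the count over
the original rows. -/
theorem card_fiber {ι T B : Type w} (Q : ι → T → B → Prop) (u : T) :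
    Nat.card {p : (ι × T) × B // p.1.2 = u ∧ Q p.1.1 p.1.2 p.2} =
      Nat.card {p : ι × B // Q p.1 u p.2} :=
  Nat.card_congr
    { toFun := fun p => ⟨(p.1.1.1, p.1.2), by
        obtain ⟨h₁, h₂⟩ := p.2
        rwa [h₁] at h₂⟩
      invFun := fun p => ⟨((p.1.1, u), p.1.2), rfl, p.2⟩
      left_inv := by
        rintro ⟨⟨⟨i, _⟩, b⟩, rfl, h⟩
        rfl
      right_inv := fun _ => rfl }

/-- The rows over a family `s`, extended by all values of the variables `Fin n` and by an activity
flag that depends on these values. -/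
def activeRows {V A ι : Type*} {n : ℕ} (s : ι → V → A) (a : (Fin n → A) → A)
    (p : ι × (Fin n → A)) : (V ⊕ Fin n) ⊕ Unit → A :=
  Sum.elim (Sum.elim (s p.1) p.2) fun _ => a p.2

theorem exists_eq_comp_snd {ι T A : Type*} [Nonempty ι] {b : ι × T → A}
    (h : ∀ p q, p.2 = q.2 → b p = b q) : ∃ a : T → A, ∀ p, b p = a p.2 :=
  ⟨fun t => b (Classical.arbitrary ι, t), fun _ => h _ _ rfl⟩

/-- Appending a value at the end of a tuple. -/
def extendEquiv (ι A : Type w) (n : ℕ) :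
    (ι × (Fin n → A)) × (Unit → A) ≃ ι × (Fin (n + 1) → A) where
  toFun p := (p.1.1, Fin.snoc p.1.2 (p.2 ()))
  invFun p := ((p.1, Fin.init p.2), fun _ => p.2 (Fin.last n))
  left_inv p := by simp
  right_inv p := by simp

/-! ### Induction on formulae -/

section formulas

variable {W V : Type} {ar : W → ℕ}

/-- `P` holds for the active rows over `s` iff `φ` holds, with respect to the weights given by `s`,
for all tuples whose activity flag is raised. -/
def Translates (c d : V) (flag : W → V) (arg : (g : W) → Fin (ar g) → V) {n : ℕ}
    (φ : FOmts L W ar n) (P : TeamCond.{u, v, w} L ((V ⊕ Fin n) ⊕ Unit)) : Prop :=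
  ∀ (𝔄 : FinStr.{u, v, w} L) (ι : Type w) [Finite ι] [Nonempty ι] (s : ι → V → 𝔄) (c₀ : 𝔄),
    (∀ i, s i c = c₀) → (∀ i, s i d ≠ c₀) → ∀ a : (Fin n → 𝔄) → 𝔄,
      P 𝔄 (ι × (Fin n → 𝔄)) (activeRows s a) ↔
        ∀ u, a u = c₀ → φ.Holds (weights flag arg s c₀) u

variable (c d : V) (flag : W → V) (arg : (g : W) → Fin (ar g) → V)

theorem exists_translates_lit {n : ℕ} (α : Literal L n) :
    ∃ P : TeamCond.{u, v, w} L ((V ⊕ Fin n) ⊕ Unit),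
      TeamDefinable P ∧ Translates c d flag arg (.lit α) P := by
  refine ⟨_, ((RowDefinable.eq (.inr ()) (.inl (.inl c))).imp
    (.lit α fun i => .inl (.inr i))).team, fun 𝔄 ι _ _ s c₀ hc _ a => ?_⟩
  constructor
  · intro h u hu
    exact h (Classical.arbitrary ι, u) (hu.trans (hc _).symm)
  · intro h p hp
    exact h p.2 (hp.trans (hc _))

theorem exists_translates_and {n : ℕ} {φ χ : FOmts L W ar n}
    (hφ : ∃ P : TeamCond.{u, v, w} L ((V ⊕ Fin n) ⊕ Unit),
      TeamDefinable P ∧ Translates c d flag arg φ P)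
    (hχ : ∃ P : TeamCond.{u, v, w} L ((V ⊕ Fin n) ⊕ Unit),
      TeamDefinable P ∧ Translates c d flag arg χ P) :
    ∃ P : TeamCond.{u, v, w} L ((V ⊕ Fin n) ⊕ Unit),
      TeamDefinable P ∧ Translates c d flag arg (.and φ χ) P := by
  obtain ⟨P, hP, h⟩ := hφ
  obtain ⟨Q, hQ, h'⟩ := hχ
  refine ⟨_, hP.and hQ, fun 𝔄 ι _ _ s c₀ hc hd a => ?_⟩
  rw [h 𝔄 ι s c₀ hc hd, h' 𝔄 ι s c₀ hc hd, ← forall₂_and]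
  rfl

/-- Two guessed flags, each a function of the tuple, select the tuples handled by each disjunct and
together cover the active ones. Both disjuncts are evaluated on the full set of rows, so the weights
stay intact. -/
theorem exists_translates_or {n : ℕ} {φ χ : FOmts L W ar n}
    (hφ : ∃ P : TeamCond.{u, v, w} L ((V ⊕ Fin n) ⊕ Unit),
      TeamDefinable P ∧ Translates c d flag arg φ P)
    (hχ : ∃ P : TeamCond.{u, v, w} L ((V ⊕ Fin n) ⊕ Unit),
      TeamDefinable P ∧ Translates c d flag arg χ P) :
    ∃ P : TeamCond.{u, v, w} L ((V ⊕ Fin n) ⊕ Unit),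
      TeamDefinable P ∧ Translates c d flag arg (.or φ χ) P := by
  classical
  obtain ⟨P, hP, h⟩ := hφ
  obtain ⟨Q, hQ, h'⟩ := hχ
  let x : Fin n → ((V ⊕ Fin n) ⊕ Unit) ⊕ Bool := fun j => .inl (.inl (.inr j))
  let σ (o : Bool) : (V ⊕ Fin n) ⊕ Unit → ((V ⊕ Fin n) ⊕ Unit) ⊕ Bool :=
    Sum.elim (fun z => .inl (.inl z)) fun _ => .inr o
  let C : ((V ⊕ Fin n) ⊕ Unit) ⊕ Bool := .inl (.inl (.inl c))
  refine ⟨_, (((((TeamDefinable.dep x (.inr false)).and (.dep x (.inr true))).and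
    ((RowDefinable.eq (.inl (.inr ())) C).imp
      ((RowDefinable.eq (.inr false) C).or (.eq (.inr true) C))).team).and
    (hP.rename (σ false))).and (hQ.rename (σ true))).exists, fun 𝔄 ι _ _ s c₀ hc hd a => ?_⟩
  have hσ : ∀ (o : Bool) (b : ι × (Fin n → 𝔄) → Bool → 𝔄) (a' : (Fin n → 𝔄) → 𝔄),
      (∀ p, b p o = a' p.2) →
        (fun p => Sum.elim (activeRows s a p) (b p) ∘ σ o) = activeRows s a' := by
    intro o b a' hb
    funext p z
    rcases z with (z | z) | z
    · rfl
    · rfl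
    · exact hb p
  constructor
  · rintro ⟨b, ⟨⟨⟨h₁, h₂⟩, h₃⟩, h₄⟩, h₅⟩ u hu
    obtain ⟨a₁, ha₁⟩ := exists_eq_comp_snd h₁
    obtain ⟨a₂, ha₂⟩ := exists_eq_comp_snd h₂
    rw [hσ false b a₁ ha₁, h 𝔄 ι s c₀ hc hd] at h₄
    rw [hσ true b a₂ ha₂, h' 𝔄 ι s c₀ hc hd] at h₅
    let p : ι × (Fin n → 𝔄) := (Classical.arbitrary ι, u)
    rcases h₃ p (hu.trans (hc p.1).symm) with h₃ | h₃
    · exact Or.inl (h₄ u ((ha₁ p).symm.trans (h₃.trans (hc p.1))))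
    · exact Or.inr (h₅ u ((ha₂ p).symm.trans (h₃.trans (hc p.1))))
  · intro H
    obtain ⟨d₀, hd₀⟩ := exists_ne c₀
    let a₁ : (Fin n → 𝔄) → 𝔄 := fun u =>
      if φ.Holds (weights flag arg s c₀) u then c₀ else d₀
    let a₂ : (Fin n → 𝔄) → 𝔄 := fun u =>
      if χ.Holds (weights flag arg s c₀) u then c₀ else d₀
    refine ⟨fun p o => cond o (a₂ p.2) (a₁ p.2), ⟨⟨⟨?_, ?_⟩, ?_⟩, ?_⟩, ?_⟩
    · intro p q hpq
      exact congrArg a₁ hpq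
    · intro p q hpq
      exact congrArg a₂ hpq
    · intro p hp
      rcases H p.2 (hp.trans (hc p.1)) with H | H
      · exact Or.inl ((if_pos H).trans (hc p.1).symm)
      · exact Or.inr ((if_pos H).trans (hc p.1).symm)
    · rw [hσ false _ a₁ fun _ => rfl, h 𝔄 ι s c₀ hc hd]
      intro u hu
      by_contra hn
      exact hd₀ ((if_neg hn).symm.trans hu)
    · rw [hσ true _ a₂ fun _ => rfl, h' 𝔄 ι s c₀ hc hd]
      intro u hu
      by_contra hn
      exact hd₀ ((if_neg hn).symm.trans hu)

/-- The new variable takes all values in every row, and the old flag, which ignores it, serves as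
the new one. -/
theorem exists_translates_all [Finite V] {n : ℕ} {φ : FOmts L W ar (n + 1)}
    (hφ : ∃ P : TeamCond.{u, v, w} L ((V ⊕ Fin (n + 1)) ⊕ Unit),
      TeamDefinable P ∧ Translates c d flag arg φ P) :
    ∃ P : TeamCond.{u, v, w} L ((V ⊕ Fin n) ⊕ Unit),
      TeamDefinable P ∧ Translates c d flag arg (.all φ) P := by
  obtain ⟨P, hP, h⟩ := hφ
  let x : Fin (n + 1) → ((V ⊕ Fin n) ⊕ Unit) ⊕ Unit :=
    Fin.snoc (fun j => .inl (.inl (.inr j))) (.inr ())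
  let σ : (V ⊕ Fin (n + 1)) ⊕ Unit → ((V ⊕ Fin n) ⊕ Unit) ⊕ Unit :=
    Sum.elim (Sum.elim (fun z => .inl (.inl (.inl z))) x) fun _ => .inl (.inr ())
  refine ⟨_, (hP.rename σ).forall, fun 𝔄 ι _ _ s c₀ hc hd a => ?_⟩
  have hσ : (fun p : (ι × (Fin n → 𝔄)) × (Unit → 𝔄) =>
      Sum.elim (activeRows s a p.1) p.2 ∘ σ) =
        fun p => activeRows s (fun u => a (Fin.init u)) (extendEquiv ι 𝔄 n p) := by
    funext p z
    rcases z with (z | z) | z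
    · rfl
    · refine Fin.lastCases ?_ (fun z => ?_) z <;> simp [σ, x, activeRows, extendEquiv]
    · simp [σ, activeRows, extendEquiv]
  rw [hσ, hP.reindex 𝔄 (extendEquiv ι 𝔄 n) (activeRows s fun u => a (Fin.init u)),
    h 𝔄 ι s c₀ hc hd]
  constructor
  · intro H u hu y
    exact H (Fin.snoc u y) (by simpa using hu)
  · intro H u hu
    simpa using H (Fin.init u) hu (u (Fin.last n))

/-- A witness depending only on the tuple is guessed in an auxiliary variable. The quantified
variable itself then ranges over all values, to keep the rows complete, and the new flag has to be
raised where it equals the witness of an active tuple. -/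
theorem exists_translates_ex [Finite V] {n : ℕ} {φ : FOmts L W ar (n + 1)}
    (hφ : ∃ P : TeamCond.{u, v, w} L ((V ⊕ Fin (n + 1)) ⊕ Unit),
      TeamDefinable P ∧ Translates c d flag arg φ P) :
    ∃ P : TeamCond.{u, v, w} L ((V ⊕ Fin n) ⊕ Unit),
      TeamDefinable P ∧ Translates c d flag arg (.ex φ) P := by
  classical
  obtain ⟨P, hP, h⟩ := hφ
  let x : Fin n → ((V ⊕ Fin n) ⊕ Unit) ⊕ Unit := fun j => .inl (.inl (.inr j))
  let x' : Fin (n + 1) → ((((V ⊕ Fin n) ⊕ Unit) ⊕ Unit) ⊕ Unit) ⊕ Unit :=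
    Fin.snoc (fun j => .inl (.inl (x j))) (.inl (.inr ()))
  let σ : (V ⊕ Fin (n + 1)) ⊕ Unit → ((((V ⊕ Fin n) ⊕ Unit) ⊕ Unit) ⊕ Unit) ⊕ Unit :=
    Sum.elim (Sum.elim (fun z => .inl (.inl (.inl (.inl (.inl z))))) x') fun _ => .inr ()
  let C : ((((V ⊕ Fin n) ⊕ Unit) ⊕ Unit) ⊕ Unit) ⊕ Unit := .inl (.inl (.inl (.inl (.inl c))))
  refine ⟨_, ((TeamDefinable.dep x (.inr ())).and
    (((TeamDefinable.dep x' (.inr ())).and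
      (((RowDefinable.eq (.inl (.inl (.inl (.inr ())))) C).and
        (.eq (.inl (.inr ())) (.inl (.inl (.inr ()))))).imp (.eq (.inr ()) C)).team).and
      (hP.rename σ)).exists.forall).exists, fun 𝔄 ι _ _ s c₀ hc hd a => ?_⟩
  let E := extendEquiv ι 𝔄 n
  have hx' : ∀ (b : ι × (Fin n → 𝔄) → Unit → 𝔄) (p : (ι × (Fin n → 𝔄)) × (Unit → 𝔄))
      (b' : Unit → 𝔄),
      Sum.elim (Sum.elim (Sum.elim (activeRows s a p.1) (b p.1)) p.2) b' ∘ x' = (E p).2 := by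
    intro b p b'
    funext z
    refine Fin.lastCases ?_ (fun z => ?_) z <;> simp [x, x', activeRows, E, extendEquiv]
  have hσ : ∀ (b : ι × (Fin n → 𝔄) → Unit → 𝔄)
      (b' : (ι × (Fin n → 𝔄)) × (Unit → 𝔄) → Unit → 𝔄) (a' : (Fin (n + 1) → 𝔄) → 𝔄),
      (∀ p, b' p () = a' (E p).2) →
        (fun p => Sum.elim (Sum.elim (Sum.elim (activeRows s a p.1) (b p.1)) p.2) (b' p) ∘ σ) =
          fun p => activeRows s a' (E p) := by
    intro b b' a' hb
    funext p z
    rcases z with (z | z) | z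
    · rfl
    · exact congrFun (hx' b p (b' p)) z
    · exact hb p
  constructor
  · rintro ⟨b, h₁, b', ⟨h₂, h₃⟩, h₄⟩ u hu
    obtain ⟨e, he⟩ := exists_eq_comp_snd h₁
    obtain ⟨a', ha'⟩ : ∃ a' : (Fin (n + 1) → 𝔄) → 𝔄, ∀ p, b' p () = a' (E p).2 := by
      obtain ⟨a', ha'⟩ := exists_eq_comp_snd (b := fun p => b' (E.symm p) ()) fun p q hpq =>
        h₂ (E.symm p) (E.symm q) (by simpa only [hx', Equiv.apply_symm_apply] using hpq)
      exact ⟨a', fun p => by simpa using ha' (E p)⟩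
    rw [hσ b b' a' ha', hP.reindex 𝔄 E (activeRows s a'), h 𝔄 ι s c₀ hc hd] at h₄
    let p : ι × (Fin n → 𝔄) := (Classical.arbitrary ι, u)
    refine ⟨e u, h₄ _ ?_⟩
    have := ha' (p, fun _ => e u)
    refine this.symm.trans ((h₃ (p, fun _ => e u) ⟨hu.trans (hc p.1).symm, ?_⟩).trans (hc p.1))
    exact (he p).symm
  · intro H
    obtain ⟨d₀, hd₀⟩ := exists_ne c₀
    have : ∀ u, ∃ y : 𝔄, a u = c₀ → φ.Holds (weights flag arg s c₀) (Fin.snoc u y) := by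
      intro u
      by_cases hu : a u = c₀
      · obtain ⟨y, hy⟩ := H u hu
        exact ⟨y, fun _ => hy⟩
      -- The witness for an inactive tuple is arbitrary.
      · exact ⟨c₀, fun h => absurd h hu⟩
    choose e he using this
    let a' : (Fin (n + 1) → 𝔄) → 𝔄 := fun u =>
      if a (Fin.init u) = c₀ ∧ u (Fin.last n) = e (Fin.init u) then c₀ else d₀
    refine ⟨fun p _ => e p.2, fun p q hpq => congrArg e hpq, fun p _ => a' (E p).2,
      ⟨fun p q hpq => ?_, fun p hp => ?_⟩, ?_⟩
    · refine congrArg a' ?_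
      rwa [hx' fun p _ => e p.2, hx' fun p _ => e p.2] at hpq
    · refine Eq.trans (if_pos ?_) (hc p.1.1).symm
      obtain ⟨h₁, h₂⟩ := hp
      simp only [E, extendEquiv, Equiv.coe_fn_mk, Fin.init_snoc, Fin.snoc_last]
      exact ⟨h₁.trans (hc p.1.1), h₂⟩
    · rw [hσ (fun p _ => e p.2) _ a' fun _ => rfl, hP.reindex 𝔄 E (activeRows s a'),
        h 𝔄 ι s c₀ hc hd]
      intro u hu
      have hcond : a (Fin.init u) = c₀ ∧ u (Fin.last n) = e (Fin.init u) := by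
        by_contra hn
        exact hd₀ ((if_neg hn).symm.trans hu)
      have := he _ hcond.1
      rwa [← hcond.2, Fin.snoc_init_self] at this

/-- Over a common block of auxiliary variables, two labels mark the active solutions for `t` and for
`t'`. Equidistribution of (tuple, label) compares the two counts for all tuples at once, and
`card_ite_eq` shows that unmarked rows add no constraint. -/
theorem exists_translates_teq [Finite V] {n : ℕ} (t t' : NumTerm L W ar n) :
    ∃ P : TeamCond.{u, v, w} L ((V ⊕ Fin n) ⊕ Unit),
      TeamDefinable P ∧ Translates c d flag arg (.teq t t') P := by
  classical
  obtain ⟨B, _, θ, hθ, h⟩ := NumTerm.exists_rowDefinable.{u, v, w} c d flag arg t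
  obtain ⟨B', _, θ', hθ', h'⟩ := NumTerm.exists_rowDefinable.{u, v, w} c d flag arg t'
  let k : B ⊕ B' → V ⊕ Fin n := fun _ => .inl c
  let η := θ.pad Sum.inl k
  let η' := θ'.pad Sum.inr k
  have hη : RowDefinable η := hθ.pad _ _
  have hη' : RowDefinable η' := hθ'.pad _ _
  let U := (((V ⊕ Fin n) ⊕ Unit) ⊕ (B ⊕ B')) ⊕ Bool
  let σ : (V ⊕ Fin n) ⊕ (B ⊕ B') → U := Sum.elim (fun z => .inl (.inl (.inl z)))
    fun b => .inl (.inr b)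
  let C : U := .inl (.inl (.inl (.inl c)))
  let act : U := .inl (.inl (.inr ()))
  let x (o : Bool) : Option (Fin n) → U :=
    fun z => z.elim (.inr o) fun j => .inl (.inl (.inl (.inr j)))
  refine ⟨_, ((((RowDefinable.eq (.inr false) C).iff
    ((RowDefinable.eq act C).and (hη.rename σ))).team.and
      ((RowDefinable.eq (.inr true) C).iff
        ((RowDefinable.eq act C).and (hη'.rename σ))).team).and
          (.equidistributed (x false) (x true))).exists.forall,
    fun 𝔄 ι _ _ s c₀ hc hd a => ?_⟩
  let row (p : (ι × (Fin n → 𝔄)) × (B ⊕ B' → 𝔄)) : (V ⊕ Fin n) ⊕ (B ⊕ B') → 𝔄 :=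
    Sum.elim (Sum.elim (s p.1.1) p.1.2) p.2
  have hσ : ∀ p (b : Bool → 𝔄), Sum.elim (Sum.elim (activeRows s a p.1) p.2) b ∘ σ = row p := by
    intro p b
    funext z
    rcases z with (z | z) | z <;> rfl
  have hx : ∀ (o : Bool) (p : (ι × (Fin n → 𝔄)) × (B ⊕ B' → 𝔄))
      (b : Bool → 𝔄) (v : Option (Fin n) → 𝔄),
      Sum.elim (Sum.elim (activeRows s a p.1) p.2) b ∘ x o = v ↔
        p.1.2 = v ∘ some ∧ b o = v none := by
    intro o p b v
    constructor
    · rintro rfl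
      exact ⟨rfl, rfl⟩
    · rintro ⟨h₁, h₂⟩
      funext z
      cases z with
      | none => exact h₂
      | some z => exact congrFun h₁ z
  have val : ∀ u, a u = c₀ → Nat.card {p : (ι × (Fin n → 𝔄)) × (B ⊕ B' → 𝔄) //
      p.1.2 = u ∧ a p.1.2 = c₀ ∧ η 𝔄 (row p)} =
      t.val (weights flag arg s c₀) u := by
    intro u hu
    rw [h 𝔄 ι s c₀ hc hd u, ← RowCond.card_pad θ Sum.inl_injective k 𝔄 fun i => Sum.elim (s i) u]
    refine (card_fiber (fun i u b => a u = c₀ ∧ η 𝔄 (Sum.elim (Sum.elim (s i) u) b)) u).trans ?_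
    simp only [hu, true_and, η]
  have val' : ∀ u, a u = c₀ → Nat.card {p : (ι × (Fin n → 𝔄)) × (B ⊕ B' → 𝔄) //
      p.1.2 = u ∧ a p.1.2 = c₀ ∧ η' 𝔄 (row p)} =
      t'.val (weights flag arg s c₀) u := by
    intro u hu
    rw [h' 𝔄 ι s c₀ hc hd u,
      ← RowCond.card_pad θ' Sum.inr_injective k 𝔄 fun i => Sum.elim (s i) u]
    refine (card_fiber (fun i u b => a u = c₀ ∧ η' 𝔄 (Sum.elim (Sum.elim (s i) u) b)) u).trans ?_
    simp only [hu, true_and, η']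
  simp only [hσ, hx]
  have hC : ∀ (p : (ι × (Fin n → 𝔄)) × (B ⊕ B' → 𝔄)) (b : Bool → 𝔄),
      Sum.elim (Sum.elim (activeRows s a p.1) p.2) b C = c₀ := fun p _ => hc p.1.1
  have hact : ∀ (p : (ι × (Fin n → 𝔄)) × (B ⊕ B' → 𝔄)) (b : Bool → 𝔄),
      Sum.elim (Sum.elim (activeRows s a p.1) p.2) b act = a p.1.2 := fun p _ => rfl
  simp only [hC, hact, Sum.elim_inr]
  constructor
  · rintro ⟨b, ⟨h₁, h₂⟩, h₃⟩ u hu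
    have := h₃ fun z => z.elim c₀ u
    simp only [Option.elim_none, h₁, h₂] at this
    rw [FOmts.Holds, ← val u hu, ← val' u hu]
    exact this
  · intro H
    obtain ⟨d₀, hd₀⟩ := exists_ne c₀
    refine ⟨fun p o => cond o (if a p.1.2 = c₀ ∧ η' 𝔄 (row p) then c₀ else d₀)
      (if a p.1.2 = c₀ ∧ η 𝔄 (row p) then c₀ else d₀), ⟨fun p => ?_, fun p => ?_⟩, fun v => ?_⟩
    · simp [hd₀]
    · simp [hd₀]
    · refine card_ite_eq hd₀ (fun p : (ι × (Fin n → 𝔄)) × (B ⊕ B' → 𝔄) => p.1.2) _ _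
        (fun u => ?_) _ _
      by_cases hu : a u = c₀
      · rw [val u hu, val' u hu]
        exact H u hu
      -- Above an inactive tuple neither label is raised, so both counts vanish.
      · refine Eq.trans (Nat.card_eq_zero.2 (.inl ⟨fun p => hu ?_⟩))
          (Nat.card_eq_zero.2 (.inl ⟨fun p => hu ?_⟩)).symm
        · exact p.2.1 ▸ p.2.2.1
        · exact p.2.1 ▸ p.2.2.1

theorem FOmts.exists_translates [Finite V] {n : ℕ} (φ : FOmts L W ar n) :
    ∃ P : TeamCond.{u, v, w} L ((V ⊕ Fin n) ⊕ Unit),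
      TeamDefinable P ∧ Translates c d flag arg φ P := by
  induction φ with
  | lit α => exact exists_translates_lit c d flag arg α
  | teq t t' => exact exists_translates_teq c d flag arg t t'
  | and φ χ ih ih' => exact exists_translates_and c d flag arg ih ih'
  | or φ χ ih ih' => exact exists_translates_or c d flag arg ih ih'
  | ex φ ih => exact exists_translates_ex c d flag arg ih
  | all φ ih => exact exists_translates_all c d flag arg ih

end formulas

/-! ### Guessing weight functions -/

/-- The disjoint union of `g t` points for each `t` embeds into `κ'`; each image point is labelled
by the `t` it comes from. -/
theorem exists_partial_labelling {κ κ' : Type w} {T : Type*} [Finite κ'] [Fintype T]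
    {j : κ' → κ} (hj : j.Injective) (g : T → ℕ) (hg : ∑ t, g t ≤ Nat.card κ') :
    ∃ Y : κ → Option T, (∀ p t, Y p = some t → p ∈ Set.range j) ∧
      ∀ t, Nat.card {p // Y p = some t} = g t := by
  classical
  let := Fintype.ofFinite κ'
  obtain ⟨E⟩ : Nonempty ((Σ t, Fin (g t)) ↪ κ') := by
    rw [Function.Embedding.nonempty_iff_card_le]
    simpa [Nat.card_eq_fintype_card] using hg
  let F : (Σ t, Fin (g t)) → κ := j ∘ E
  have hF : F.Injective := hj.comp E.injective
  let Y : κ → Option T := Function.extend F (some ∘ Sigma.fst) fun _ => none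
  have hY : ∀ x, Y (F x) = some x.1 := fun x => hF.extend_apply _ _ x
  have hY' : ∀ p t, Y p = some t → ∃ x, F x = p := by
    intro p t hp
    by_contra hn
    rw [show Y p = none from Function.extend_apply' _ _ _ hn] at hp
    cases hp
  refine ⟨Y, fun p t hp => ?_, fun t => ?_⟩
  · obtain ⟨x, rfl⟩ := hY' p t hp
    exact ⟨E x, rfl⟩
  · rw [← Nat.card_fin (g t)]
    refine (Nat.card_eq_of_bijective
      (fun x : Fin (g t) => (⟨F ⟨t, x⟩, hY _⟩ : {p // Y p = some t})) ⟨?_, ?_⟩).symm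
    · intro x y hxy
      have := hF (congrArg Subtype.val hxy)
      simpa using this
    · rintro ⟨p, hp⟩
      obtain ⟨⟨t', x⟩, rfl⟩ := hY' p t hp
      obtain rfl : t' = t := by simpa using (hY ⟨t', x⟩).symm.trans hp
      exact ⟨x, rfl⟩

theorem card_eq_sum_card_fiber {κ T : Type*} [Finite κ] [Fintype T] (p : κ → Prop) (x : κ → T) :
    Nat.card {i // p i} = ∑ t, Nat.card {i // p i ∧ x i = t} := by
  classical
  rw [← Nat.card_sigma]
  exact Nat.card_congr
    { toFun := fun i => ⟨x i, i, i.2, rfl⟩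
      invFun := fun q => ⟨q.2, q.2.2.1⟩
      left_inv := fun _ => rfl
      right_inv := by
        rintro ⟨_, i, h, rfl⟩
        rfl }

namespace ESOmts

variable {k : ℕ} (ψ : ESOmts L k)

/-- Universally quantified variables providing `|A|^ℓᵢ` copies of each assignment for each `i`. -/
abbrev Copies : Type := Σ i : Fin ψ.m, Fin (ψ.expo i)

/-- For each weight function symbol, a flag variable and variables for its arguments. -/
abbrev Guess : Type :=
  Σ h : Option (Fin ψ.m), Option (Fin (weightArity k ψ.arity h))

/-- The variables of the translation of `ψ`: the given ones, two for distinct values, and those for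
the copies and guesses. -/
abbrev Vars : Type := ((Fin k ⊕ Bool) ⊕ ψ.Copies) ⊕ ψ.Guess

/-- The variable for the value that marks raised flags. -/
abbrev markVar : ψ.Vars := .inl (.inl (.inr false))

/-- The variable for a value different from the mark. -/
abbrev otherVar : ψ.Vars := .inl (.inl (.inr true))

abbrev flagVar (h : Option (Fin ψ.m)) : ψ.Vars := .inr ⟨h, none⟩

abbrev argVar (h : Option (Fin ψ.m)) (j : Fin (weightArity k ψ.arity h)) : ψ.Vars :=
  .inr ⟨h, some j⟩

/-- The guessed flags are consistent: the flag of `f` marks one copy of each assignment, which is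
the argument of `f`, and the flag of `gᵢ` is raised in at most `|A|^ℓᵢ` copies of each assignment. -/
def Consistent (𝔄 : FinStr.{u, v, w} L) (r : ψ.Vars → 𝔄) : Prop :=
  (r (ψ.flagVar none) = r ψ.markVar ↔ ∀ z : ψ.Copies, r (.inl (.inr z)) = r ψ.markVar) ∧
    (∀ j : Fin k, r (ψ.argVar none j) = r (.inl (.inl (.inl j)))) ∧
      ∀ i : Fin ψ.m, r (ψ.flagVar (some i)) = r ψ.markVar →
        ∀ z : {z : ψ.Copies // z.1 ≠ i}, r (.inl (.inr z.1)) = r ψ.markVar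

theorem rowDefinable_consistent : RowDefinable (ψ.Consistent : RowCond.{u, v, w} L ψ.Vars) :=
  ((RowDefinable.eq _ _).iff (.forall fun _ => .eq _ _)).and
    ((RowDefinable.forall fun _ => .eq _ _).and
      (.forall fun _ => (RowDefinable.eq _ _).imp (.forall fun _ => .eq _ _)))

section rows

variable {ψ} {A ι : Type w}

/-- The rows over a family `s` with all values for the copies and given values for the guesses. -/
def rows (s : ι → Fin k → A) (e : Bool → A)
    (b : ι × (ψ.Copies → A) → ψ.Guess → A) (p : ι × (ψ.Copies → A)) : ψ.Vars → A :=
  Sum.elim (Sum.elim (Sum.elim (s p.1) e) p.2) (b p)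

end rows

/-- The flag of `f` is raised exactly where all copy variables equal the mark, which is one copy of
each row of `s`. -/
theorem weights_none {𝔄 : FinStr.{u, v, w} L} {ι : Type w} (s : ι → Fin k → 𝔄)
    (e : Bool → 𝔄) (b : ι × (ψ.Copies → 𝔄) → ψ.Guess → 𝔄)
    (h : ∀ p, ψ.Consistent 𝔄 (rows s e b p)) (a : Fin k → 𝔄) :
    weights ψ.flagVar ψ.argVar (rows s e b) (e false) none a = Nat.card {i // s i = a} := by
  refine Nat.card_congr
    { toFun := fun p => ⟨p.1.1, ?_⟩
      invFun := fun i => ⟨(i, fun _ => e false), ?_, ?_⟩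
      left_inv := ?_
      right_inv := fun _ => rfl }
  · exact (funext (h p).2.1).symm.trans p.2.2
  · exact (h _).1.2 fun _ => rfl
  · exact (funext (h _).2.1).trans i.2
  · rintro ⟨⟨i, z⟩, h₁, h₂⟩
    refine Subtype.ext (Prod.ext rfl (funext fun x => ?_))
    exact ((h (i, z)).1.1 h₁ x).symm

/-- Where the flag of gᵢ is raised, the copy variables of all other indices equal the mark, so such
a row is determined by its member of `ι` and the `expo i` copy variables of `i`. -/
theorem sum_weights_some_le {𝔄 : FinStr.{u, v, w} L} {ι : Type w} [Finite ι] (s : ι → Fin k → 𝔄)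
    (e : Bool → 𝔄) (b : ι × (ψ.Copies → 𝔄) → ψ.Guess → 𝔄)
    (h : ∀ p, ψ.Consistent 𝔄 (rows s e b p)) (i : Fin ψ.m) :
    ∑ a : Fin (ψ.arity i) → 𝔄, weights ψ.flagVar ψ.argVar (rows s e b) (e false) (some i) a ≤
      Nat.card ι * Fintype.card 𝔄 ^ ψ.expo i := by
  have : Nat.card (ι × (Fin (ψ.expo i) → 𝔄)) = Nat.card ι * Fintype.card 𝔄 ^ ψ.expo i := by
    rw [Nat.card_prod, Nat.card_fun, Nat.card_fin, Nat.card_eq_fintype_card (α := 𝔄)]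
  rw [← this]
  refine (card_eq_sum_card_fiber (fun p => rows s e b p (ψ.flagVar (some i)) = e false)
    fun p => rows s e b p ∘ ψ.argVar (some i)).symm.trans_le ?_
  refine Nat.card_le_card_of_injective (fun p => (p.1.1, fun j => p.1.2 ⟨i, j⟩)) ?_
  rintro ⟨⟨l, z⟩, hz⟩ ⟨⟨l', z'⟩, hz'⟩ heq
  obtain ⟨h₁, h₂⟩ := Prod.mk.inj heq
  refine Subtype.ext (Prod.ext h₁ (funext fun x => ?_))
  obtain ⟨i', x⟩ := x
  by_cases hi : i' = i
  · subst hi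
    exact congrFun h₂ x
  · exact ((h (l, z)).2.2 i hz ⟨⟨i', x⟩, hi⟩).trans ((h (l', z')).2.2 i hz' ⟨⟨i', x⟩, hi⟩).symm

theorem exists_guess {𝔄 : FinStr.{u, v, w} L} {ι : Type w} [Finite ι] (s : ι → Fin k → 𝔄)
    {e : Bool → 𝔄} (he : e false ≠ e true) (g : (i : Fin ψ.m) → (Fin (ψ.arity i) → 𝔄) → ℕ)
    (hg : ∀ i, ∑ a, g i a ≤ Nat.card ι * Fintype.card 𝔄 ^ ψ.expo i) :
    ∃ b : ι × (ψ.Copies → 𝔄) → ψ.Guess → 𝔄, (∀ p, ψ.Consistent 𝔄 (rows s e b p)) ∧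
      ∀ i (a : Fin (ψ.arity i) → 𝔄),
        weights ψ.flagVar ψ.argVar (rows s e b) (e false) (some i) a = g i a := by
  classical
  have : ∀ i, ∃ Y : ι × (ψ.Copies → 𝔄) → Option (Fin (ψ.arity i) → 𝔄),
      (∀ p t, Y p = some t → ∀ z : ψ.Copies, z.1 ≠ i → p.2 z = e false) ∧
        ∀ t, Nat.card {p // Y p = some t} = g i t := by
    intro i
    -- The rows allowed to carry gᵢ are those with the mark in all copy variables of other indices;
    -- their number is exactly the bound on gᵢ.
    let j (q : ι × (Fin (ψ.expo i) → 𝔄)) : ι × (ψ.Copies → 𝔄) :=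
      (q.1, fun z => if h : z.1 = i then q.2 (h ▸ z.2) else e false)
    have hj : j.Injective := by
      rintro ⟨l, q⟩ ⟨l', q'⟩ heq
      obtain ⟨h₁, h₂⟩ := Prod.mk.inj heq
      refine Prod.ext h₁ (funext fun x => ?_)
      simpa using congrFun h₂ ⟨i, x⟩
    obtain ⟨Y, hY, hY'⟩ := exists_partial_labelling hj (g i) (by
      rw [Nat.card_prod, Nat.card_fun, Nat.card_fin, Nat.card_eq_fintype_card (α := 𝔄)]
      exact hg i)
    refine ⟨Y, fun p t hp z hz => ?_, hY'⟩
    obtain ⟨q, rfl⟩ := hY p t hp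
    exact dif_neg hz
  choose Y hY hY' using this
  let b : ι × (ψ.Copies → 𝔄) → ψ.Guess → 𝔄 := fun p x =>
    match x with
    | ⟨none, none⟩ => if ∀ z, p.2 z = e false then e false else e true
    | ⟨none, some j⟩ => s p.1 j
    | ⟨some i, none⟩ => if (Y i p).isSome then e false else e true
    -- The default is immaterial: in rows without a label the flag is not raised.
    | ⟨some i, some j⟩ => (Y i p).getD (fun _ => e false) j
  have flag : ∀ i p, (if (Y i p).isSome then e false else e true) = e false ↔ (Y i p).isSome := by
    intro i p
    split_ifs with h <;> simp [h, he.symm]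
  refine ⟨b, fun p => ⟨?_, fun j => rfl, fun i hi z => ?_⟩, fun i a => ?_⟩
  · change (if ∀ z, p.2 z = e false then e false else e true) = e false ↔ ∀ z, p.2 z = e false
    split_ifs with h
    · exact iff_of_true rfl h
    · exact iff_of_false he.symm h
  · obtain ⟨t, ht⟩ := Option.isSome_iff_exists.1 ((flag i p).1 hi)
    exact hY i p t ht z.1 z.2
  · rw [← hY' i a]
    refine Nat.card_congr (Equiv.subtypeEquivRight fun p => ?_)
    change (if (Y i p).isSome then e false else e true) = e false ∧
      (Y i p).getD (fun _ => e false) = a ↔ _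
    rw [flag]
    cases Y i p <;> simp

/-- The total |f| is the number of rows of `s`, so the functions within the bounds are precisely
those encoded by consistent guesses. -/
theorem holds_iff_exists_guess (𝔄 : FinStr.{u, v, w} L) {ι : Type w} [Finite ι]
    (s : ι → Fin k → 𝔄) {e : Bool → 𝔄} (he : e false ≠ e true) {f : (Fin k → 𝔄) → ℕ}
    (hf : ∀ a, Nat.card {i // s i = a} = f a) :
    ψ.Holds f ↔ ∃ b : ι × (ψ.Copies → 𝔄) → ψ.Guess → 𝔄,
      (∀ p, ψ.Consistent 𝔄 (rows s e b p)) ∧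
        ψ.body.Holds (weights ψ.flagVar ψ.argVar (rows s e b) (e false)) Fin.elim0 := by
  have hι : ∑ a, f a = Nat.card ι := by
    simp only [← hf]
    rw [← Nat.card_sigma]
    exact Nat.card_congr (Equiv.sigmaFiberEquiv s)
  rw [ESOmts.Holds, hι]
  constructor
  · rintro ⟨g, hg, h⟩
    obtain ⟨b, hb, hw⟩ := ψ.exists_guess s he g hg
    refine ⟨b, hb, ?_⟩
    convert h using 1
    funext x a
    cases x with
    | none => exact (ψ.weights_none s e b hb a).trans (hf a)
    | some i => exact hw i a
  · rintro ⟨b, hb, h⟩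
    refine ⟨fun i => weights ψ.flagVar ψ.argVar (rows s e b) (e false) (some i),
      ψ.sum_weights_some_le s e b hb, ?_⟩
    convert h using 1
    funext x a
    cases x with
    | none => exact ((ψ.weights_none s e b hb a).trans (hf a)).symm
    | some i => rfl

/-- The truth of `ψ(f)` is a definable property of the non-empty families that represent `f`. -/
theorem exists_teamDefinable : ∃ P : TeamCond.{u, v, w} L (Fin k), TeamDefinable P ∧
    ∀ (𝔄 : FinStr.{u, v, w} L) (ι : Type w) [Finite ι] [Nonempty ι] (s : ι → Fin k → 𝔄)
      (f : (Fin k → 𝔄) → ℕ), (∀ a, Nat.card {i // s i = a} = f a) →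
        (P 𝔄 ι s ↔ ψ.Holds f) := by
  obtain ⟨P, hP, h⟩ := ψ.body.exists_translates.{u, v, w} ψ.markVar ψ.otherVar ψ.flagVar ψ.argVar
  -- A sentence has only the empty tuple to evaluate; reading its activity flag from the mark makes
  -- it active.
  let σ : (ψ.Vars ⊕ Fin 0) ⊕ Unit → ψ.Vars :=
    Sum.elim (Sum.elim id Fin.elim0) fun _ => ψ.markVar
  -- Dependence on the empty tuple makes the mark and the other value constant throughout the team.
  refine ⟨_, ((((TeamDefinable.dep Fin.elim0 (.inr false)).and
    (.dep Fin.elim0 (.inr true))).and (RowDefinable.eq (.inr false) (.inr true)).not.team).and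
      (ψ.rowDefinable_consistent.team.and (hP.rename σ)).exists.forall).exists,
    fun 𝔄 ι _ _ s f hf => ?_⟩
  have key : ∀ (e : Bool → 𝔄) (b : ι × (ψ.Copies → 𝔄) → ψ.Guess → 𝔄), e false ≠ e true →
      (P 𝔄 (ι × (ψ.Copies → 𝔄)) (fun p => rows s e b p ∘ σ) ↔
        ψ.body.Holds (weights ψ.flagVar ψ.argVar (rows s e b) (e false)) Fin.elim0) := by
    intro e b he
    have h₁ := h 𝔄 (ι × (ψ.Copies → 𝔄)) (rows s e b) (e false) (fun _ => rfl)
      (fun _ => he.symm) fun _ => e false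
    have h₂ : activeRows (rows s e b) (fun _ : Fin 0 → 𝔄 => e false) =
        fun p => rows s e b (Equiv.prodUnique _ (Fin 0 → 𝔄) p) ∘ σ := by
      funext p z
      rcases z with (z | z) | z
      · rfl
      · exact z.elim0
      · rfl
    rw [h₂, hP.reindex 𝔄 (Equiv.prodUnique _ (Fin 0 → 𝔄)) fun p => rows s e b p ∘ σ] at h₁
    refine h₁.trans ⟨fun H => H _ rfl, fun H u _ => ?_⟩
    rwa [Subsingleton.elim u Fin.elim0]
  constructor
  · rintro ⟨e', ⟨⟨h₁, h₂⟩, h₃⟩, b, h₄, h₅⟩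
    obtain ⟨e, rfl⟩ : ∃ e : Bool → 𝔄, e' = fun _ => e := by
      let i₀ : ι := Classical.arbitrary ι
      refine ⟨e' i₀, funext fun i => funext fun o => ?_⟩
      cases o
      · exact h₁ i i₀ (Subsingleton.elim _ _)
      · exact h₂ i i₀ (Subsingleton.elim _ _)
    have he : e false ≠ e true := h₃ (Classical.arbitrary ι)
    exact (ψ.holds_iff_exists_guess 𝔄 s he hf).2 ⟨b, h₄, (key e b he).1 h₅⟩
  · intro H
    obtain ⟨c, d, hcd⟩ := exists_pair_ne 𝔄
    let e : Bool → 𝔄 := fun o => cond o d c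
    obtain ⟨b, hb, H⟩ := (ψ.holds_iff_exists_guess 𝔄 s (e := e) hcd hf).1 H
    exact ⟨fun _ => e, ⟨⟨fun _ _ _ => rfl, fun _ _ _ => rfl⟩, fun _ => hcd⟩, b, hb,
      (key e b hcd).2 H⟩

end ESOmts

end MultiteamLogic

/-! ### The theorem, for the family of occurrences in the multiteam of `f` -/

theorem mainTheorem3 (L : FirstOrder.Language.{u, v}) [L.IsRelational] (k : ℕ)
    (ψ : MultiteamLogic.ESOmts L k)
    (hψ : ∀ (A : Type w) [L.Structure A] [Fintype A] [Nontrivial A],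
      ψ.Holds (fun _ : Fin k → A => 0)) :
    ∃ φ : MultiteamLogic.FOM L k,
      ∀ (A : Type w) [L.Structure A] [Fintype A] [Nontrivial A]
        (f : (Fin k → A) → ℕ), MultiteamLogic.Multiteam.ofFun f ≠ 0 →
          (φ.Sat (MultiteamLogic.Multiteam.ofFun f) ↔ ψ.Holds f) := by
  classical
  obtain ⟨P, hP, h⟩ := MultiteamLogic.ESOmts.exists_teamDefinable.{u, v, w} ψ
  obtain ⟨φ, hφ⟩ := hP k id
  refine ⟨φ, fun A _ _ _ f hf => ?_⟩
  let M := MultiteamLogic.Multiteam.ofFun f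
  let s : M → Fin k → A := fun p => p.1
  have hs : MultiteamLogic.fam s = M := MultiteamLogic.fam_toType M
  have : Nonempty M := by
    obtain ⟨a, ha⟩ := Multiset.exists_mem_of_ne_zero hf
    exact ⟨⟨a, 0, Multiset.count_pos.2 ha⟩⟩
  have hcount : ∀ a, Nat.card {i // s i = a} = f a := by
    intro a
    rw [← MultiteamLogic.count_fam s a, hs]
    exact MultiteamLogic.Multiteam.count_ofFun f a
  have h₁ := hφ ⟨A⟩ M s
  rw [show MultiteamLogic.fam s = MultiteamLogic.Multiteam.ofFun f from hs] at h₁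
  exact h₁.trans (h ⟨A⟩ M s f hcount)
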